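/- Let $k$ be a perfect field of characteristic $p>0$. For a field extension $K/k$, let $K^{\mathrm{perf}}$ be the perfect closure of $K$, and let $\mathcal D_\infty(K/k)$ be the category of triples $(V,W,\psi)$, where $V$ is a finite dimensional $K$-vector space, $W$ is a finite dimensional $k$-vector space and $\psi\colon K^{\mathrm{perf}}\otimes_K V\to K^{\mathrm{perf}}\otimes_k W$ is a $K^{\mathrm{perf}}$-linear isomorphism; a morphism $(V,W,\psi)\to(V',W',\psi')$ is a pair consisting of a $K$-linear map $V\to V'$ and a $k$-linear map $W\to W'$ compatible with $\psi$ and $\psi'$. With the natural tensor product and the fibre functor $\omega\colon(V,W,\psi)\mapsto W$ it is a neutral Tannakian category over $k$. The local Nori fundamental group $\pi^{\mathrm L}(K/k)$ is its Tannakian group, that is, the affine group scheme over $k$ that represents the functor $R\mapsto\mathrm{Aut}^{\otimes}(R\otimes_k\omega)$ on commutative $k$-algebras. A $k$-homomorphism $K\to L$ of field extensions of $k$ induces a homomorphism $\pi^{\mathrm L}(L/k)\to\pi^{\mathrm L}(K/k)$, by restriction along the pullback functor $(V,W,\psi)\mapsto(L\otimes_K V,\,W,\,L^{\mathrm{perf}}\otimes_{K^{\mathrm{perf}}}\psi)$.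 **Theorem I.** Let $K/k$ be a field extension, and let $\mathrm{PI}(K)$ be the category of purely inseparable field extensions of $K$ and $K$-homomorphisms; there is at most one morphism between any two of its objects, so it is equivalent to a partially ordered set. 1. The contravariant functor $L\mapsto(\pi^{\mathrm L}(L/k)\to\pi^{\mathrm L}(K/k))$ from $\mathrm{PI}(K)$ to the category of affine group schemes over $k$ equipped with a homomorphism to $\pi^{\mathrm L}(K/k)$ is fully faithful. 2. For every $L\in\mathrm{PI}(K)$ the homomorphism $\pi^{\mathrm L}(L/k)\to\pi^{\mathrm L}(K/k)$ is a closed immersion. The resulting map, which sends $L$ to the closed subgroup scheme $\pi^{\mathrm L}(L/k)\subseteq\pi^{\mathrm L}(K/k)$, is well defined on the partially ordered set of isomorphism classes of $\mathrm{PI}(K)$, and it is an order-reversing embedding of that set into the closed subgroup schemes of $\pi^{\mathrm L}(K/k)$: for $L_1,L_2\in\mathrm{PI}(K)$ one has $\pi^{\mathrm L}(L_1/k)\subseteq\pi^{\mathrm L}(L_2/k)$ if and only if there is a $K$-homomorphism $L_2\to L_1$. -/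

import Mathlib

open CategoryTheory TensorProduct

universe u

noncomputable section

namespace LocalNori

/-! ### Perfect closures -/

section Perf

variable (p : ℕ) [Fact p.Prime]

/-- The perfect closure of `K` is an algebra over every ring over which `K` is an algebra
(in particular over `K` itself). -/
instance perfAlgebra (k K : Type u) [Field k] [Field K] [CharP K p] [Algebra k K] :
    Algebra k (PerfectClosure K p) :=
  ((PerfectClosure.of K p).comp (algebraMap k K)).toAlgebra

theorem algebraMap_perf (k K : Type u) [Field k] [Field K] [CharP K p] [Algebra k K] (x : k) :
    algebraMap k (PerfectClosure K p) x = PerfectClosure.of K p (algebraMap k K x) := rfl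

instance perfTower (k K L : Type u) [Field k] [Field K] [Field L] [CharP L p] [Algebra k K]
    [Algebra k L] [Algebra K L] [IsScalarTower k K L] :
    IsScalarTower k K (PerfectClosure L p) :=
  IsScalarTower.of_algebraMap_eq fun x => by
    rw [algebraMap_perf, algebraMap_perf, IsScalarTower.algebraMap_apply k K L]

/-- The homomorphism of perfect closures induced by a homomorphism of fields over `k`. -/
def perfMap {k K L : Type u} [Field k] [Field K] [Field L] [CharP K p] [CharP L p]
    [Algebra k K] [Algebra k L] (f : K →ₐ[k] L) :
    PerfectClosure K p →ₐ[k] PerfectClosure L p where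
  __ := PerfectClosure.lift K p (PerfectClosure L p) ((PerfectClosure.of L p).comp f.toRingHom)
  commutes' x := by
    have h := (PerfectClosure.lift K p (PerfectClosure L p)).symm_apply_apply
      ((PerfectClosure.of L p).comp f.toRingHom)
    have h' := RingHom.congr_fun h (algebraMap k K x)
    have h'' : PerfectClosure.of L p (f (algebraMap k K x)) = algebraMap k _ x := by
      rw [AlgHom.commutes]; rfl
    exact h'.trans h''

theorem perfMap_of {k K L : Type u} [Field k] [Field K] [Field L] [CharP K p] [CharP L p]
    [Algebra k K] [Algebra k L] (f : K →ₐ[k] L) (x : K) :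
    perfMap p f (PerfectClosure.of K p x) = PerfectClosure.of L p (f x) :=
  RingHom.congr_fun ((PerfectClosure.lift K p (PerfectClosure L p)).symm_apply_apply
      ((PerfectClosure.of L p).comp f.toRingHom)) x

theorem perfMap_unique {k K L : Type u} [Field k] [Field K] [Field L] [CharP K p] [CharP L p]
    [Algebra k K] [Algebra k L] {g h : PerfectClosure K p →ₐ[k] PerfectClosure L p}
    (H : ∀ x, g (PerfectClosure.of K p x) = h (PerfectClosure.of K p x)) : g = h := by
  have : (g : PerfectClosure K p →+* PerfectClosure L p) = h :=
    (PerfectClosure.lift K p (PerfectClosure L p)).symm.injective (RingHom.ext H)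
  exact AlgHom.ext (RingHom.congr_fun this)

theorem perfMap_id {k K : Type u} [Field k] [Field K] [CharP K p] [Algebra k K] :
    perfMap p (AlgHom.id k K) = AlgHom.id k _ :=
  perfMap_unique p fun x => by rw [perfMap_of]; rfl

theorem perfMap_comp {k K L M : Type u} [Field k] [Field K] [Field L] [Field M] [CharP K p]
    [CharP L p] [CharP M p] [Algebra k K] [Algebra k L] [Algebra k M]
    (g : L →ₐ[k] M) (f : K →ₐ[k] L) :
    perfMap p (g.comp f) = (perfMap p g).comp (perfMap p f) :=
  perfMap_unique p fun x => by
    rw [AlgHom.comp_apply, perfMap_of, perfMap_of, perfMap_of]; rfl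

end Perf

/-! ### The category of triples -/

section Triples

variable (p : ℕ) [Fact p.Prime] (k K : Type u) [Field k] [Field K] [CharP K p] [Algebra k K]

/-- Triples `(V, W, ψ)`: a finite dimensional `K`-vector space `V`, a finite dimensional
`k`-vector space `W`, and a linear isomorphism between their extensions to the perfect closure
of `K`. -/
structure Triple where
  V : Type u
  W : Type u
  [addCommGroupV : AddCommGroup V]
  [moduleV : Module K V]
  [finiteV : FiniteDimensional K V]
  [addCommGroupW : AddCommGroup W]
  [moduleW : Module k W]
  [finiteW : FiniteDimensional k W]
  ψ : PerfectClosure K p ⊗[K] V ≃ₗ[PerfectClosure K p] PerfectClosure K p ⊗[k] W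

attribute [instance] Triple.addCommGroupV Triple.moduleV Triple.finiteV Triple.addCommGroupW
  Triple.moduleW Triple.finiteW

variable {p k K}

namespace Triple

/-- Morphisms of triples: pairs of linear maps compatible with the isomorphisms. -/
@[ext]
structure Hom (X Y : Triple p k K) where
  a : X.V →ₗ[K] Y.V
  b : X.W →ₗ[k] Y.W
  comm : ∀ z, Y.ψ (a.baseChange (PerfectClosure K p) z) =
    b.baseChange (PerfectClosure K p) (X.ψ z)

instance : Category (Triple p k K) where
  Hom := Hom
  id X := ⟨LinearMap.id, LinearMap.id, fun z => by simp⟩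
  comp f g := ⟨g.a ∘ₗ f.a, g.b ∘ₗ f.b, fun z => by
    simp [LinearMap.baseChange_comp, f.comm, g.comm]⟩

/-- The tensor product of triples. -/
def tensor (X Y : Triple p k K) : Triple p k K where
  V := X.V ⊗[K] Y.V
  W := X.W ⊗[k] Y.W
  ψ := AlgebraTensorModule.distribBaseChange K (PerfectClosure K p) X.V Y.V ≪≫ₗ
    TensorProduct.congr X.ψ Y.ψ ≪≫ₗ
    (AlgebraTensorModule.distribBaseChange k (PerfectClosure K p) X.W Y.W).symm

variable (p k K) in
/-- The unit triple `(K, k, id)`. -/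
def unit : Triple p k K where
  V := K
  W := k
  ψ := AlgebraTensorModule.rid K (PerfectClosure K p) (PerfectClosure K p) ≪≫ₗ
    (AlgebraTensorModule.rid k (PerfectClosure K p) (PerfectClosure K p)).symm

end Triple

end Triples

/-! ### Tensor automorphisms of the fibre functor -/

section Push

variable {k : Type u} [Field k] {R S T : Type u} [CommRing R] [CommRing S] [CommRing T]
  [Algebra k R] [Algebra k S] [Algebra k T] (W : Type u) [AddCommGroup W] [Module k W]

/-- The change of coefficients `R ⊗ W → S ⊗ W` along `f : R → S`. -/
abbrev coeffMap (f : R →ₐ[k] S) : R ⊗[k] W →ₗ[k] S ⊗[k] W := f.toLinearMap.rTensor W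

theorem coeffMap_smul (f : R →ₐ[k] S) (r : R) (z : R ⊗[k] W) :
    coeffMap W f (r • z) = f r • coeffMap W f z := by
  induction z with
  | zero => simp
  | tmul a w => simp [TensorProduct.smul_tmul']
  | add x y hx hy => simp only [smul_add, map_add, hx, hy]

/-- The base change along `f : R → S` of an endomorphism of the `R`-module `R ⊗ W`: the unique
endomorphism of the `S`-module `S ⊗ W` compatible with it, see `pushEnd_coeffMap`. -/
def pushEndFun (f : R →ₐ[k] S) (g : Module.End R (R ⊗[k] W)) : Module.End S (S ⊗[k] W) :=
  LinearMap.liftBaseChange S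
    (coeffMap W f ∘ₗ g.restrictScalars k ∘ₗ TensorProduct.mk k R W 1)

theorem pushEndFun_coeffMap (f : R →ₐ[k] S) (g : Module.End R (R ⊗[k] W)) (z : R ⊗[k] W) :
    pushEndFun W f g (coeffMap W f z) = coeffMap W f (g z) := by
  induction z with
  | zero => simp
  | tmul a w =>
    have : a ⊗ₜ[k] w = a • ((1 : R) ⊗ₜ[k] w) := by simp [TensorProduct.smul_tmul']
    rw [this, coeffMap_smul, map_smul, map_smul, coeffMap_smul]
    simp [pushEndFun]
  | add x y hx hy => simp only [map_add, hx, hy]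

theorem end_ext_coeffMap (f : R →ₐ[k] S) {M : Type u} [AddCommGroup M] [Module S M]
    {g h : S ⊗[k] W →ₗ[S] M}
    (H : ∀ z : R ⊗[k] W, g (coeffMap W f z) = h (coeffMap W f z)) : g = h := by
  refine LinearMap.ext fun z => ?_
  induction z with
  | zero => simp
  | add x y hx hy => simp only [map_add, hx, hy]
  | tmul a w =>
    have h : a ⊗ₜ[k] w = a • coeffMap W f (1 ⊗ₜ w) := by simp [TensorProduct.smul_tmul']
    rw [h, map_smul, map_smul, H]

/-- Base change of endomorphisms as a homomorphism of monoids. -/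
def pushEnd (f : R →ₐ[k] S) : Module.End R (R ⊗[k] W) →* Module.End S (S ⊗[k] W) where
  toFun := pushEndFun W f
  map_one' := end_ext_coeffMap W f fun z => by rw [pushEndFun_coeffMap]; rfl
  map_mul' g h := end_ext_coeffMap W f fun z => by
    rw [pushEndFun_coeffMap, Module.End.mul_apply, Module.End.mul_apply, pushEndFun_coeffMap,
      pushEndFun_coeffMap]

theorem pushEnd_coeffMap (f : R →ₐ[k] S) (g : Module.End R (R ⊗[k] W)) (z : R ⊗[k] W) :
    pushEnd W f g (coeffMap W f z) = coeffMap W f (g z) := pushEndFun_coeffMap W f g z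

theorem coeffMap_comp_apply (f : R →ₐ[k] S) (g : S →ₐ[k] T) (z : R ⊗[k] W) :
    coeffMap W (g.comp f) z = coeffMap W g (coeffMap W f z) := by
  rw [coeffMap, AlgHom.comp_toLinearMap, LinearMap.rTensor_comp]; rfl

theorem coeffMap_baseChange {W W' : Type u} [AddCommGroup W] [Module k W] [AddCommGroup W']
    [Module k W'] (f : R →ₐ[k] S) (b : W →ₗ[k] W') (z : R ⊗[k] W) :
    coeffMap W' f (b.baseChange R z) = b.baseChange S (coeffMap W f z) := by
  induction z with
  | zero => simp
  | tmul a w => simp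
  | add x y hx hy => simp only [map_add, hx, hy]

theorem coeffMap_distrib {W W' : Type u} [AddCommGroup W] [Module k W] [AddCommGroup W']
    [Module k W'] (f : R →ₐ[k] S) (z : R ⊗[k] W) (z' : R ⊗[k] W') :
    coeffMap (W ⊗[k] W') f ((AlgebraTensorModule.distribBaseChange k R W W').symm (z ⊗ₜ z')) =
      (AlgebraTensorModule.distribBaseChange k S W W').symm
        (coeffMap W f z ⊗ₜ coeffMap W' f z') := by
  induction z with
  | zero => simp
  | add x y hx hy => simp only [map_add, hx, hy, TensorProduct.add_tmul]
  | tmul a w =>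
    induction z' with
    | zero => simp
    | add x y hx hy => simp only [map_add, hx, hy, TensorProduct.tmul_add]
    | tmul a' w' => simp [AlgebraTensorModule.distribBaseChange_symm_tmul]

end Push

section Aut

variable (p : ℕ) [Fact p.Prime] (k K : Type u) [Field k] [Field K] [CharP K p] [Algebra k K]

variable {p k K} in
/-- The canonical isomorphism `(R ⊗ W) ⊗_R (R ⊗ W') ≃ R ⊗ (W ⊗ W')`, where `W` and `W'` are the
images of two triples under the fibre functor; `W ⊗ W'` is the image of their tensor product. -/
def tensorIso (R : Type u) [CommRing R] [Algebra k R] (X Y : Triple p k K) :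
    (R ⊗[k] X.W) ⊗[R] (R ⊗[k] Y.W) ≃ₗ[R] R ⊗[k] (X.tensor Y).W :=
  (AlgebraTensorModule.distribBaseChange k R X.W Y.W).symm

variable {p k K} in
theorem coeffMap_tensorIso {R S : Type u} [CommRing R] [Algebra k R] [CommRing S] [Algebra k S]
    (f : R →ₐ[k] S) (X Y : Triple p k K) (z : R ⊗[k] X.W) (z' : R ⊗[k] Y.W) :
    coeffMap (X.tensor Y).W f (tensorIso R X Y (z ⊗ₜ z')) =
      tensorIso S X Y (coeffMap X.W f z ⊗ₜ coeffMap Y.W f z') :=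
  coeffMap_distrib f z z'

/-- The conditions on a family `g` of `R`-linear automorphisms of the modules `R ⊗ W`, for
`(V, W, ψ)` a triple, to be a tensor automorphism of the functor `(V, W, ψ) ↦ R ⊗ W`. -/
structure IsTensorAut (R : Type u) [CommRing R] [Algebra k R]
    (g : ∀ X : Triple p k K, (Module.End R (R ⊗[k] X.W))ˣ) : Prop where
  natural : ∀ {X Y : Triple p k K} (f : X ⟶ Y) (z : R ⊗[k] X.W),
    (g Y).val (f.b.baseChange R z) = f.b.baseChange R ((g X).val z)
  tensor : ∀ (X Y : Triple p k K) (z : R ⊗[k] X.W) (z' : R ⊗[k] Y.W),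
    (g (X.tensor Y)).val (tensorIso R X Y (z ⊗ₜ z')) =
      tensorIso R X Y ((g X).val z ⊗ₜ (g Y).val z')
  unit : ∀ z : R ⊗[k] (Triple.unit p k K).W, (g (Triple.unit p k K)).val z = z

/-- The group of tensor automorphisms of the functor `(V, W, ψ) ↦ R ⊗ W`. -/
def tensorAut (R : Type u) [CommRing R] [Algebra k R] :
    Subgroup (∀ X : Triple p k K, (Module.End R (R ⊗[k] X.W))ˣ) where
  carrier := {g | IsTensorAut p k K R g}
  one_mem' := ⟨fun _ _ => rfl, fun _ _ _ _ => rfl, fun _ => rfl⟩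
  mul_mem' {g h} hg hh :=
    ⟨fun f z => by
      simp only [Pi.mul_apply, Units.val_mul, Module.End.mul_apply, hh.natural, hg.natural],
     fun X Y z z' => by
      simp only [Pi.mul_apply, Units.val_mul, Module.End.mul_apply, hh.tensor, hg.tensor],
     fun z => by
      simp only [Pi.mul_apply, Units.val_mul, Module.End.mul_apply, hh.unit, hg.unit]⟩
  inv_mem' {g} hg := by
    have l : ∀ X z, (g X).val ((g X)⁻¹.val z) = z := fun X z => by
      rw [← Module.End.mul_apply, Units.mul_inv]; rfl
    have r : ∀ X z, (g X)⁻¹.val ((g X).val z) = z := fun X z => by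
      rw [← Module.End.mul_apply, Units.inv_mul]; rfl
    refine ⟨fun {X Y} f z => ?_, fun X Y z z' => ?_, fun z => ?_⟩
    · have := hg.natural f ((g X)⁻¹.val z)
      rw [l] at this
      rw [Pi.inv_apply, ← this, r]; rfl
    · have := hg.tensor X Y ((g X)⁻¹.val z) ((g Y)⁻¹.val z')
      rw [l, l] at this
      rw [Pi.inv_apply, ← this, r]; rfl
    · have := hg.unit z
      rw [Pi.inv_apply, ← this, r]; exact this.symm

variable {p k K} in
theorem coeffMap_units {R S : Type u} [CommRing R] [Algebra k R] [CommRing S] [Algebra k S]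
    (f : R →ₐ[k] S) (W : Type u) [AddCommGroup W] [Module k W]
    (g : (Module.End R (R ⊗[k] W))ˣ) (z : R ⊗[k] W) :
    (Units.map (pushEnd W f) g).val (coeffMap W f z) = coeffMap W f (g.val z) :=
  pushEnd_coeffMap W f g.val z

/-- Base change of tensor automorphisms. -/
def tensorAutMap {R S : Type u} [CommRing R] [Algebra k R] [CommRing S] [Algebra k S]
    (f : R →ₐ[k] S) : tensorAut p k K R →* tensorAut p k K S where
  toFun g := ⟨fun X => Units.map (pushEnd X.W f) (g.1 X), by
    have hg : IsTensorAut p k K R g.1 := g.2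
    refine ⟨fun {X Y} b z => ?_, fun X Y z z' => ?_, fun z => ?_⟩
    · suffices h : (Units.map (pushEnd Y.W f) (g.1 Y)).val ∘ₗ b.b.baseChange S =
          b.b.baseChange S ∘ₗ (Units.map (pushEnd X.W f) (g.1 X)).val from LinearMap.congr_fun h z
      refine end_ext_coeffMap X.W f fun z => ?_
      rw [LinearMap.comp_apply, LinearMap.comp_apply, ← coeffMap_baseChange, coeffMap_units,
        hg.natural, coeffMap_units, coeffMap_baseChange]
    · induction z with
      | zero => simp
      | add x y hx hy => simp only [map_add, hx, hy, TensorProduct.add_tmul]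
      | tmul a w =>
        induction z' with
        | zero => simp
        | add x y hx hy => simp only [map_add, hx, hy, TensorProduct.tmul_add]
        | tmul a' w' =>
          have h1 : a ⊗ₜ[k] w = a • coeffMap X.W f (1 ⊗ₜ w) := by
            simp [TensorProduct.smul_tmul']
          have h2 : a' ⊗ₜ[k] w' = a' • coeffMap Y.W f (1 ⊗ₜ w') := by
            simp [TensorProduct.smul_tmul']
          rw [h1, h2]
          simp only [TensorProduct.smul_tmul_smul, map_smul]
          rw [← coeffMap_tensorIso, coeffMap_units, coeffMap_units, coeffMap_units, hg.tensor,
            coeffMap_tensorIso]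
    · suffices h : (Units.map (pushEnd (Triple.unit p k K).W f) (g.1 (Triple.unit p k K))).val =
          LinearMap.id from LinearMap.congr_fun h z
      refine end_ext_coeffMap _ f fun z => ?_
      rw [coeffMap_units, hg.unit]; rfl⟩
  map_one' := Subtype.ext (funext fun X => map_one _)
  map_mul' g h := Subtype.ext (funext fun X => map_mul _ _ _)

end Aut

/-! ### Pullback of triples and functoriality -/

section Pullback

variable {p : ℕ} [Fact p.Prime] {k K L M : Type u} [Field k] [Field K] [Field L] [Field M]
  [CharP K p] [CharP L p] [CharP M p] [Algebra k K] [Algebra k L] [Algebra k M]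

/-- The isomorphism of a pulled back triple: the extension of `ψ` along `K^perf → L^perf`, with
the identifications `L^perf ⊗_L (L ⊗_K V) = L^perf ⊗_{K^perf} (K^perf ⊗_K V)` and
`L^perf ⊗_{K^perf} (K^perf ⊗_k W) = L^perf ⊗_k W`. -/
def pullbackIso [Algebra K L] [Algebra (PerfectClosure K p) (PerfectClosure L p)]
    [IsScalarTower K (PerfectClosure K p) (PerfectClosure L p)]
    [IsScalarTower k (PerfectClosure K p) (PerfectClosure L p)] (X : Triple p k K) :
    PerfectClosure L p ⊗[L] (L ⊗[K] X.V) ≃ₗ[PerfectClosure L p] PerfectClosure L p ⊗[k] X.W :=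
  AlgebraTensorModule.cancelBaseChange K L (PerfectClosure L p) (PerfectClosure L p) X.V ≪≫ₗ
  (AlgebraTensorModule.cancelBaseChange K (PerfectClosure K p) (PerfectClosure L p)
    (PerfectClosure L p) X.V).symm ≪≫ₗ
  LinearEquiv.baseChange (PerfectClosure K p) (PerfectClosure L p) _ _ X.ψ ≪≫ₗ
  AlgebraTensorModule.cancelBaseChange k (PerfectClosure K p) (PerfectClosure L p)
    (PerfectClosure L p) X.W

/-- The pullback of a triple along a homomorphism `f : K → L` of extensions of `k`, with
underlying vector spaces `L ⊗_K V` and `W`. -/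
def Triple.pullback (f : K →ₐ[k] L) (X : Triple p k K) : Triple p k L :=
  letI : Algebra K L := f.toRingHom.toAlgebra
  letI : Algebra (PerfectClosure K p) (PerfectClosure L p) := (perfMap p f).toRingHom.toAlgebra
  haveI : IsScalarTower K (PerfectClosure K p) (PerfectClosure L p) :=
    IsScalarTower.of_algebraMap_eq fun x => (perfMap_of p f x).symm
  haveI : IsScalarTower k (PerfectClosure K p) (PerfectClosure L p) :=
    IsScalarTower.of_algebraMap_eq fun x => ((perfMap p f).commutes x).symm
  { V := L ⊗[K] X.V
    W := X.W
    ψ := pullbackIso X }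

/-- Morphisms of triples over a homomorphism `f : K → L`: an `f`-semilinear map and a `k`-linear
map, compatible with the isomorphisms. They are the morphisms out of the pullback along `f`. -/
structure SemiHom (f : K →ₐ[k] L) (X : Triple p k K) (Y : Triple p k L) where
  a : X.V →ₛₗ[(f : K →+* L)] Y.V
  b : X.W →ₗ[k] Y.W
  comm : ∀ v, Y.ψ (1 ⊗ₜ a v) = TensorProduct.map (perfMap p f).toLinearMap b (X.ψ (1 ⊗ₜ v))

/-- The canonical morphism from a triple to its pullback. -/
def SemiHom.toPullback (f : K →ₐ[k] L) (X : Triple p k K) : SemiHom f X (X.pullback f) :=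
  letI : Algebra K L := f.toRingHom.toAlgebra
  letI : Algebra (PerfectClosure K p) (PerfectClosure L p) := (perfMap p f).toRingHom.toAlgebra
  haveI : IsScalarTower K (PerfectClosure K p) (PerfectClosure L p) :=
    IsScalarTower.of_algebraMap_eq fun x => (perfMap_of p f x).symm
  haveI : IsScalarTower k (PerfectClosure K p) (PerfectClosure L p) :=
    IsScalarTower.of_algebraMap_eq fun x => ((perfMap p f).commutes x).symm
  { a :=
    { toFun := fun v => (1 : L) ⊗ₜ[K] v
      map_add' := fun v w => TensorProduct.tmul_add _ _ _
      map_smul' := fun c v => by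
        change (1 : L) ⊗ₜ[K] (c • v) = (f c) • ((1 : L) ⊗ₜ[K] v)
        rw [← TensorProduct.smul_tmul, TensorProduct.smul_tmul', Algebra.smul_def, smul_eq_mul]
        rfl }
    b := (LinearMap.id : X.W →ₗ[k] X.W)
    comm := fun v => by
      change pullbackIso X ((1 : PerfectClosure L p) ⊗ₜ[L] ((1 : L) ⊗ₜ[K] v)) =
        TensorProduct.map (perfMap p f).toLinearMap (LinearMap.id : X.W →ₗ[k] X.W) _
      simp only [pullbackIso, LinearEquiv.trans_apply, AlgebraTensorModule.cancelBaseChange_tmul,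
        AlgebraTensorModule.cancelBaseChange_symm_tmul, one_smul, LinearEquiv.baseChange_tmul]
      generalize X.ψ (1 ⊗ₜ v) = z
      induction z with
      | zero => simp
      | add x y hx hy => simp only [map_add, TensorProduct.tmul_add, hx, hy]
      | tmul c w =>
        rw [AlgebraTensorModule.cancelBaseChange_tmul, TensorProduct.map_tmul, Algebra.smul_def,
          mul_one]
        rfl }

/-- A morphism over `f` factors through the pullback. -/
theorem SemiHom.exists_lift {f : K →ₐ[k] L} {X : Triple p k K} {Y : Triple p k L}
    (h : SemiHom f X Y) :
    ∃ h' : X.pullback f ⟶ Y, ∀ w : X.W, h'.b ((SemiHom.toPullback f X).b w) = h.b w := by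
  let _ : Algebra K L := f.toRingHom.toAlgebra
  let _ : Algebra (PerfectClosure K p) (PerfectClosure L p) := (perfMap p f).toRingHom.toAlgebra
  have : IsScalarTower K (PerfectClosure K p) (PerfectClosure L p) :=
    IsScalarTower.of_algebraMap_eq fun x => (perfMap_of p f x).symm
  have : IsScalarTower k (PerfectClosure K p) (PerfectClosure L p) :=
    IsScalarTower.of_algebraMap_eq fun x => ((perfMap p f).commutes x).symm
  let _ : Module K Y.V := Module.compHom Y.V (f : K →+* L)
  have : IsScalarTower K L Y.V := ⟨fun c l y => by
    rw [Algebra.smul_def, mul_smul]; rfl⟩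
  let a₀ : X.V →ₗ[K] Y.V :=
    { toFun := h.a, map_add' := h.a.map_add, map_smul' := fun c v => h.a.map_smulₛₗ c v }
  let a₁ : L ⊗[K] X.V →ₗ[L] Y.V := LinearMap.liftBaseChange L a₀
  refine ⟨⟨a₁, h.b, ?_⟩, fun w => rfl⟩
  intro z
  let b₁ : X.W →ₗ[k] Y.W := h.b
  have key : ∀ z : PerfectClosure L p ⊗[L] (L ⊗[K] X.V),
      Y.ψ (a₁.baseChange (PerfectClosure L p) z) =
      b₁.baseChange (PerfectClosure L p) (pullbackIso X z) := by
    intro z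
    induction z with
    | zero => simp
    | add x y hx hy => simp only [map_add, hx, hy]
    | tmul c t =>
      induction t with
      | zero => simp
      | add x y hx hy => simp only [map_add, TensorProduct.tmul_add, hx, hy]
      | tmul l v =>
        have e : c ⊗ₜ[L] (l ⊗ₜ[K] v) =
            (l • c) • ((1 : PerfectClosure L p) ⊗ₜ[L] ((1 : L) ⊗ₜ[K] v)) := by
          rw [TensorProduct.smul_tmul', smul_eq_mul, mul_one, TensorProduct.smul_tmul,
            TensorProduct.smul_tmul', smul_eq_mul, mul_one]
        have e2 : pullbackIso X ((1 : PerfectClosure L p) ⊗ₜ[L] ((1 : L) ⊗ₜ[K] v)) =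
          TensorProduct.map (perfMap p f).toLinearMap (LinearMap.id : X.W →ₗ[k] X.W)
            (X.ψ (1 ⊗ₜ v)) := (SemiHom.toPullback f X).comm v
        rw [e]
        simp only [map_smul]
        rw [e2, LinearMap.baseChange_tmul, LinearMap.liftBaseChange_tmul, one_smul]
        congr 1
        refine (h.comm v).trans ?_
        generalize X.ψ (1 ⊗ₜ v) = z
        induction z with
        | zero => simp
        | add x y hx hy => simp only [map_add, hx, hy]
        | tmul c w => simp [b₁]
  exact key z

/-- Composition of a morphism of triples with a morphism over `f`. -/
def SemiHom.precomp {f : K →ₐ[k] L} {X X' : Triple p k K} {Y : Triple p k L} (m : X ⟶ X')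
    (h : SemiHom f X' Y) : SemiHom f X Y where
  a := h.a.comp m.a
  b := h.b ∘ₗ m.b
  comm v := by
    have := m.comm (1 ⊗ₜ v)
    rw [LinearMap.baseChange_tmul] at this
    rw [LinearMap.comp_apply, h.comm, this]
    generalize X.ψ (1 ⊗ₜ v) = z
    induction z with
    | zero => simp
    | add x y hx hy => simp only [map_add, hx, hy]
    | tmul c w => simp

/-- Composition of morphisms over `f` and over `g`. -/
def SemiHom.comp {f : K →ₐ[k] L} {g : L →ₐ[k] M} {X : Triple p k K} {Y : Triple p k L}
    {Z : Triple p k M} (h : SemiHom f X Y) (h' : SemiHom g Y Z) : SemiHom (g.comp f) X Z where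
  a :=
    { toFun := fun v => h'.a (h.a v)
      map_add' := fun v w => by simp only [map_add]
      map_smul' := fun c v => by rw [h.a.map_smulₛₗ, h'.a.map_smulₛₗ]; rfl }
  b := h'.b ∘ₗ h.b
  comm v := by
    have : Z.ψ (1 ⊗ₜ h'.a (h.a v)) = _ := (h'.comm (h.a v)).trans (by rw [h.comm v])
    refine this.trans ?_
    generalize X.ψ (1 ⊗ₜ v) = z
    induction z with
    | zero => simp
    | add x y hx hy => simp only [map_add, hx, hy]
    | tmul c w => simp [perfMap_comp]

/-- The identity as a morphism over the identity. -/
def SemiHom.id (X : Triple p k K) : SemiHom (AlgHom.id k K) X X where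
  a := { toFun := fun v => v, map_add' := fun _ _ => rfl, map_smul' := fun _ _ => rfl }
  b := LinearMap.id
  comm v := by
    rw [perfMap_id]
    change X.ψ (1 ⊗ₜ v) = TensorProduct.map LinearMap.id LinearMap.id (X.ψ (1 ⊗ₜ v))
    simp

/-- Tensor product of morphisms over `f`. -/
def SemiHom.tensor {f : K →ₐ[k] L} {X X' : Triple p k K} {Y Y' : Triple p k L}
    (h : SemiHom f X Y) (h' : SemiHom f X' Y') : SemiHom f (X.tensor X') (Y.tensor Y') where
  a := TensorProduct.map h.a h'.a
  b := TensorProduct.map h.b h'.b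
  comm v := by
    let P := PerfectClosure K p
    let Q := PerfectClosure L p
    have key : ∀ (z : P ⊗[k] X.W) (z' : P ⊗[k] X'.W),
        (AlgebraTensorModule.distribBaseChange k Q Y.W Y'.W).symm
          (TensorProduct.map (perfMap p f).toLinearMap h.b z ⊗ₜ[Q]
            TensorProduct.map (perfMap p f).toLinearMap h'.b z') =
        TensorProduct.map (perfMap p f).toLinearMap (TensorProduct.map h.b h'.b)
          ((AlgebraTensorModule.distribBaseChange k P X.W X'.W).symm (z ⊗ₜ[P] z')) := by
      intro z z'
      induction z with
      | zero => simp
      | add x y hx hy => simp only [map_add, TensorProduct.add_tmul, hx, hy]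
      | tmul c w =>
        induction z' with
        | zero => simp
        | add x y hx hy => simp only [map_add, TensorProduct.tmul_add, hx, hy]
        | tmul c' w' => simp [AlgebraTensorModule.distribBaseChange_symm_tmul]
    have d : ∀ (A B C D : Type u) [Field A] [CommRing B] [Algebra A B] [AddCommGroup C]
        [Module A C] [AddCommGroup D] [Module A D] (c : C) (e : D),
        AlgebraTensorModule.distribBaseChange A B C D (1 ⊗ₜ (c ⊗ₜ e)) =
          ((1 : B) ⊗ₜ[A] c) ⊗ₜ[B] ((1 : B) ⊗ₜ[A] e) := by
      intro A B C D _ _ _ _ _ _ _ c e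
      rw [← LinearEquiv.eq_symm_apply, AlgebraTensorModule.distribBaseChange_symm_tmul, one_mul]
    have main : ∀ v : X.V ⊗[K] X'.V, (AlgebraTensorModule.distribBaseChange k Q Y.W Y'.W).symm
          (TensorProduct.congr Y.ψ Y'.ψ
            (AlgebraTensorModule.distribBaseChange L Q Y.V Y'.V
              (1 ⊗ₜ (TensorProduct.map h.a h'.a v)))) =
        TensorProduct.map (perfMap p f).toLinearMap (TensorProduct.map h.b h'.b)
          ((AlgebraTensorModule.distribBaseChange k P X.W X'.W).symm
            (TensorProduct.congr X.ψ X'.ψ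
              (AlgebraTensorModule.distribBaseChange K P X.V X'.V (1 ⊗ₜ v)))) := by
      intro v
      induction v with
      | zero => simp
      | add x y hx hy => simp only [map_add, TensorProduct.tmul_add, hx, hy]
      | tmul v v' =>
        rw [TensorProduct.map_tmul, d, d, TensorProduct.congr_tmul, TensorProduct.congr_tmul,
          h.comm, h'.comm, key]
    exact main v

variable (p) in
/-- The canonical morphism between the unit triples. -/
def SemiHom.unit (f : K →ₐ[k] L) : SemiHom f (Triple.unit p k K) (Triple.unit p k L) where
  a :=
    { toFun := fun x => f x
      map_add' := fun x y => map_add f x y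
      map_smul' := fun c x => map_mul f c x }
  b := (LinearMap.id : k →ₗ[k] k)
  comm v := by
    have main : ∀ v : K, (AlgebraTensorModule.rid k (PerfectClosure L p) (PerfectClosure L p)).symm
        (AlgebraTensorModule.rid L (PerfectClosure L p) (PerfectClosure L p) (1 ⊗ₜ f v)) =
      TensorProduct.map (perfMap p f).toLinearMap (LinearMap.id : k →ₗ[k] k)
        ((AlgebraTensorModule.rid k (PerfectClosure K p) (PerfectClosure K p)).symm
          (AlgebraTensorModule.rid K (PerfectClosure K p) (PerfectClosure K p) (1 ⊗ₜ v))) := by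
      intro v
      rw [AlgebraTensorModule.rid_tmul, AlgebraTensorModule.rid_tmul,
        AlgebraTensorModule.rid_symm_apply, AlgebraTensorModule.rid_symm_apply,
        TensorProduct.map_tmul, Algebra.smul_def, Algebra.smul_def, mul_one, mul_one,
        algebraMap_perf, algebraMap_perf, AlgHom.toLinearMap_apply]
      exact congrArg (· ⊗ₜ[k] (1 : k)) (perfMap_of p f v).symm
    exact main v

/-- The restriction of a family of automorphisms along the pullback functor. -/
def resFamily (f : K →ₐ[k] L) {R : Type u} [CommRing R] [Algebra k R]
    (g : ∀ Y : Triple p k L, (Module.End R (R ⊗[k] Y.W))ˣ) (X : Triple p k K) :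
    (Module.End R (R ⊗[k] X.W))ˣ :=
  g (X.pullback f)

theorem toPullback_baseChange (f : K →ₐ[k] L) {R : Type u} [CommRing R] [Algebra k R]
    (X : Triple p k K) (z : R ⊗[k] X.W) :
    (SemiHom.toPullback f X).b.baseChange R z = z := by
  change (LinearMap.id : X.W →ₗ[k] X.W).baseChange R z = z
  rw [LinearMap.baseChange_id]; rfl

/-- The restriction of a tensor automorphism is natural for morphisms over `f`. -/
theorem resFamily_natural {f : K →ₐ[k] L} {R : Type u} [CommRing R] [Algebra k R]
    {g : ∀ Y : Triple p k L, (Module.End R (R ⊗[k] Y.W))ˣ} (hg : IsTensorAut p k L R g)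
    {X : Triple p k K} {Y : Triple p k L} (h : SemiHom f X Y) (z : R ⊗[k] X.W) :
    (g Y).val (h.b.baseChange R z) = h.b.baseChange R ((resFamily f g X).val z) := by
  obtain ⟨h', hh⟩ := h.exists_lift
  have e : h.b = h'.b ∘ₗ (SemiHom.toPullback f X).b := LinearMap.ext fun w => (hh w).symm
  rw [e, LinearMap.baseChange_comp, LinearMap.comp_apply, LinearMap.comp_apply, hg.natural,
    toPullback_baseChange, toPullback_baseChange]
  rfl

theorem baseChange_tensorIso {f : K →ₐ[k] L} {R : Type u} [CommRing R] [Algebra k R]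
    {X X' : Triple p k K} {Y Y' : Triple p k L} (h : SemiHom f X Y) (h' : SemiHom f X' Y')
    (z : R ⊗[k] X.W) (z' : R ⊗[k] X'.W) :
    (h.tensor h').b.baseChange R (tensorIso R X X' (z ⊗ₜ z')) =
      tensorIso R Y Y' (h.b.baseChange R z ⊗ₜ h'.b.baseChange R z') := by
  change (TensorProduct.map h.b h'.b).baseChange R
      ((AlgebraTensorModule.distribBaseChange k R X.W X'.W).symm (z ⊗ₜ z')) =
    (AlgebraTensorModule.distribBaseChange k R Y.W Y'.W).symm
      (h.b.baseChange R z ⊗ₜ h'.b.baseChange R z')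
  induction z with
  | zero => simp
  | add x y hx hy => simp only [map_add, TensorProduct.add_tmul, hx, hy]
  | tmul c w =>
    induction z' with
    | zero => simp
    | add x y hx hy => simp only [map_add, TensorProduct.tmul_add, hx, hy]
    | tmul c' w' => simp [AlgebraTensorModule.distribBaseChange_symm_tmul]

theorem isTensorAut_resFamily (f : K →ₐ[k] L) {R : Type u} [CommRing R] [Algebra k R]
    {g : ∀ Y : Triple p k L, (Module.End R (R ⊗[k] Y.W))ˣ} (hg : IsTensorAut p k L R g) :
    IsTensorAut p k K R (resFamily f g) := by
  refine ⟨fun {X Y} m z => ?_, fun X Y z z' => ?_, fun z => ?_⟩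
  · have := resFamily_natural hg (SemiHom.precomp m (SemiHom.toPullback f Y)) z
    simp only [SemiHom.precomp, LinearMap.baseChange_comp, LinearMap.comp_apply,
      toPullback_baseChange] at this
    exact this
  · let t := (SemiHom.toPullback f X).tensor (SemiHom.toPullback f Y)
    have inj : Function.Injective (t.b.baseChange R) := by
      have : t.b = (LinearMap.id : X.W ⊗[k] Y.W →ₗ[k] X.W ⊗[k] Y.W) := by
        change TensorProduct.map (LinearMap.id : X.W →ₗ[k] X.W)
          (LinearMap.id : Y.W →ₗ[k] Y.W) = _
        exact TensorProduct.map_id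
      rw [this]
      erw [LinearMap.baseChange_id]
      exact fun _ _ h => h
    apply inj
    rw [← resFamily_natural hg t, baseChange_tensorIso, baseChange_tensorIso, hg.tensor,
      toPullback_baseChange, toPullback_baseChange, toPullback_baseChange, toPullback_baseChange]
    rfl
  · have := resFamily_natural hg (SemiHom.unit p f) z
    rw [hg.unit] at this
    have h2 : ∀ z : R ⊗[k] (Triple.unit p k K).W, (SemiHom.unit p f).b.baseChange R z = z := by
      intro z
      change (LinearMap.id : k →ₗ[k] k).baseChange R z = z
      rw [LinearMap.baseChange_id]; rfl
    rw [h2, h2] at this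
    exact this.symm

variable (p) in
/-- Restriction of tensor automorphisms along `f : K → L`. -/
def res (f : K →ₐ[k] L) (R : Type u) [CommRing R] [Algebra k R] :
    tensorAut p k L R →* tensorAut p k K R where
  toFun g := ⟨resFamily f g.1, isTensorAut_resFamily f g.2⟩
  map_one' := rfl
  map_mul' _ _ := rfl

theorem res_id (R : Type u) [CommRing R] [Algebra k R] (g : tensorAut p k K R) :
    res p (AlgHom.id k K) R g = g := by
  refine Subtype.ext (funext fun X => Units.ext (LinearMap.ext fun z => ?_))
  have := resFamily_natural g.2 (SemiHom.id X) z
  simp only [SemiHom.id, LinearMap.baseChange_id, LinearMap.id_apply] at this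
  exact this.symm

theorem res_comp (g : L →ₐ[k] M) (f : K →ₐ[k] L) (R : Type u) [CommRing R] [Algebra k R]
    (t : tensorAut p k M R) : res p (g.comp f) R t = res p f R (res p g R t) := by
  refine Subtype.ext (funext fun X => Units.ext (LinearMap.ext fun z => ?_))
  have := resFamily_natural t.2
    ((SemiHom.toPullback f X).comp (SemiHom.toPullback g (X.pullback f))) z
  have e : ∀ z : R ⊗[k] X.W, ((SemiHom.toPullback f X).comp
      (SemiHom.toPullback g (X.pullback f))).b.baseChange R z = z := by
    intro z
    change (LinearMap.id ∘ₗ LinearMap.id : X.W →ₗ[k] X.W).baseChange R z = z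
    rw [LinearMap.comp_id, LinearMap.baseChange_id]; rfl
  rw [e, e] at this
  exact this.symm

end Pullback

/-! ### Representability of the functor of tensor automorphisms -/

section Representable

variable (p : ℕ) [Fact p.Prime] (k K : Type u) [Field k] [Field K] [CharP K p] [Algebra k K]

/-- The functor `R ↦ Aut^⊗((V, W, ψ) ↦ R ⊗ W)` from `k`-algebras to groups. -/
def autFunctor : CommAlgCat.{u} k ⥤ GrpCat.{u + 1} where
  obj R := GrpCat.of (tensorAut p k K R)
  map f := GrpCat.ofHom (tensorAutMap p k K f.hom)
  map_id R := by
    refine GrpCat.hom_ext (MonoidHom.ext fun g => ?_)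
    refine Subtype.ext (funext fun X => Units.ext ?_)
    refine end_ext_coeffMap X.W (AlgHom.id k R) fun z => ?_
    have e : ∀ z : R ⊗[k] X.W, coeffMap X.W (AlgHom.id k R) z = z := fun z =>
      LinearMap.rTensor_id_apply _ _ z
    exact (coeffMap_units (AlgHom.id k R) X.W (g.1 X) z).trans (by rw [e, e]; rfl)
  map_comp {R S T} f h := by
    refine GrpCat.hom_ext (MonoidHom.ext fun g => ?_)
    refine Subtype.ext (funext fun X => Units.ext ?_)
    refine end_ext_coeffMap X.W (h.hom.comp f.hom) fun z => ?_
    refine (coeffMap_units (h.hom.comp f.hom) X.W (g.1 X) z).trans ?_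
    rw [coeffMap_comp_apply, coeffMap_comp_apply]
    refine Eq.trans ?_ (coeffMap_units h.hom X.W _ (coeffMap X.W f.hom z)).symm
    exact congrArg _ (coeffMap_units f.hom X.W (g.1 X) z).symm

/-- Matrices over the perfect closure: every triple is determined up to isomorphism by one. -/
abbrev Code : Type u := Σ n m : ℕ, Matrix (Fin m) (Fin n) (PerfectClosure K p)

variable {p k K}

/-- The matrix `c` describes the triple `X` in suitable bases. -/
def HasCode (X : Triple p k K) (c : Code p K) : Prop :=
  ∃ (bV : Module.Basis (Fin c.1) K X.V) (bW : Module.Basis (Fin c.2.1) k X.W),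
    ∀ j, X.ψ (1 ⊗ₜ bV j) = ∑ i, c.2.2 i j ⊗ₜ bW i

theorem exists_code (X : Triple p k K) : ∃ c, HasCode X c := by
  let bV := Module.finBasis K X.V
  let bW := Module.finBasis k X.W
  refine ⟨⟨_, _, fun i j => (bW.baseChange (PerfectClosure K p)).repr (X.ψ (1 ⊗ₜ bV j)) i⟩,
    bV, bW, fun j => ?_⟩
  conv_lhs => rw [← (bW.baseChange (PerfectClosure K p)).sum_repr (X.ψ (1 ⊗ₜ bV j))]
  refine Finset.sum_congr rfl fun i _ => ?_
  rw [Module.Basis.baseChange_apply, TensorProduct.smul_tmul', smul_eq_mul, mul_one]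

theorem HasCode.exists_hom {X Y : Triple p k K} {c : Code p K} (hX : HasCode X c)
    (hY : HasCode Y c) : ∃ (f : X ⟶ Y) (g : Y ⟶ X), (∀ w, g.b (f.b w) = w) ∧
      ∀ w, f.b (g.b w) = w := by
  obtain ⟨bV, bW, h⟩ := hX
  obtain ⟨bV', bW', h'⟩ := hY
  have aux : ∀ {X Y : Triple p k K} (bV : Module.Basis (Fin c.1) K X.V)
      (bW : Module.Basis (Fin c.2.1) k X.W) (bV' : Module.Basis (Fin c.1) K Y.V)
      (bW' : Module.Basis (Fin c.2.1) k Y.W)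
      (_ : ∀ j, X.ψ (1 ⊗ₜ bV j) = ∑ i, c.2.2 i j ⊗ₜ bW i)
      (_ : ∀ j, Y.ψ (1 ⊗ₜ bV' j) = ∑ i, c.2.2 i j ⊗ₜ bW' i) (z),
      Y.ψ ((bV.equiv bV' (Equiv.refl _)).toLinearMap.baseChange (PerfectClosure K p) z) =
        (bW.equiv bW' (Equiv.refl _)).toLinearMap.baseChange (PerfectClosure K p) (X.ψ z) := by
    intro X Y bV bW bV' bW' h h' z
    suffices e : Y.ψ.toLinearMap ∘ₗ
        (bV.equiv bV' (Equiv.refl _)).toLinearMap.baseChange (PerfectClosure K p) =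
        (bW.equiv bW' (Equiv.refl _)).toLinearMap.baseChange (PerfectClosure K p) ∘ₗ
          X.ψ.toLinearMap from LinearMap.congr_fun e z
    refine (bV.baseChange (PerfectClosure K p)).ext fun j => ?_
    simp [h, h', Module.Basis.equiv_apply]
  refine ⟨⟨(bV.equiv bV' (Equiv.refl _)).toLinearMap, (bW.equiv bW' (Equiv.refl _)).toLinearMap,
    aux bV bW bV' bW' h h'⟩, ⟨(bV'.equiv bV (Equiv.refl _)).toLinearMap,
      (bW'.equiv bW (Equiv.refl _)).toLinearMap, aux bV' bW' bV bW h' h⟩, fun w => ?_, fun w => ?_⟩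
  · exact (bW.equiv bW' (Equiv.refl _)).symm_apply_apply w
  · exact (bW.equiv bW' (Equiv.refl _)).apply_symm_apply w

open Classical in
/-- A triple with the given code, if there is one. -/
def rep (c : Code p K) : Triple p k K :=
  if h : ∃ X : Triple p k K, HasCode X c then h.choose else Triple.unit p k K

theorem exists_rep (X : Triple p k K) : ∃ (c : Code p K) (f : X ⟶ rep c) (g : rep c ⟶ X),
    (∀ w, g.b (f.b w) = w) ∧ ∀ w, f.b (g.b w) = w := by
  obtain ⟨c, hc⟩ := exists_code X
  have h : ∃ X : Triple p k K, HasCode X c := ⟨X, hc⟩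
  have : HasCode (rep (k := k) c) c := by rw [rep, dif_pos h]; exact h.choose_spec
  exact ⟨c, hc.exists_hom this⟩

/-- The chosen basis of the fibre of `rep c`. -/
abbrev repBasis (c : Code p K) := Module.finBasis k (rep (k := k) c).W

variable (p k K) in
/-- The matrix coefficients on the triples `rep c`, of an automorphism and of its inverse. -/
abbrev Coeff : Type u := Σ c : Code p K, Bool ×
  (Fin (Module.finrank k (rep (k := k) c).W) × Fin (Module.finrank k (rep (k := k) c).W))

/-- An automorphism or its inverse. -/
def signed {R : Type u} [CommRing R] [Algebra k R] (g : tensorAut p k K R) (s : Bool) :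
    tensorAut p k K R := if s then g else g⁻¹

/-- The matrix coefficients of a tensor automorphism. -/
def point {R : Type u} [CommRing R] [Algebra k R] (g : tensorAut p k K R) (x : Coeff p k K) : R :=
  ((repBasis x.1).baseChange R).repr
    (((signed g x.2.1).1 (rep x.1)).val (1 ⊗ₜ repBasis x.1 x.2.2.2)) x.2.2.1

variable (p k K) in
/-- The polynomials in the matrix coefficients that vanish on all tensor automorphisms. -/
def coordIdeal : Ideal (MvPolynomial (Coeff p k K) k) :=
  ⨅ (R : CommAlgCat.{u} k) (g : tensorAut p k K R),
    RingHom.ker (MvPolynomial.aeval (R := k) (point g))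

variable (p k K) in
/-- The coordinate ring of the group scheme of tensor automorphisms. -/
abbrev CoordRing : Type u := MvPolynomial (Coeff p k K) k ⧸ coordIdeal p k K

/-- Evaluation of coordinate functions at a tensor automorphism. -/
def evalAt (R : CommAlgCat.{u} k) (g : tensorAut p k K R) : CoordRing p k K →ₐ[k] R :=
  Ideal.Quotient.liftₐ _ (MvPolynomial.aeval (R := k) (point g)) fun _ hx =>
    (Submodule.mem_iInf _).1 ((Submodule.mem_iInf _).1 hx R) g

theorem evalAt_mk (R : CommAlgCat.{u} k) (g : tensorAut p k K R) (x) :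
    evalAt R g (Ideal.Quotient.mk _ x) = MvPolynomial.aeval (R := k) (point g) x := rfl

theorem coordRing_ext {x y : CoordRing p k K}
    (h : ∀ (R : CommAlgCat.{u} k) (g : tensorAut p k K R), evalAt R g x = evalAt R g y) :
    x = y := by
  obtain ⟨x, rfl⟩ := Ideal.Quotient.mk_surjective x
  obtain ⟨y, rfl⟩ := Ideal.Quotient.mk_surjective y
  refine Ideal.Quotient.eq.2 ?_
  refine (Submodule.mem_iInf _).2 fun R => (Submodule.mem_iInf _).2 fun g => ?_
  have := h R g
  rw [evalAt_mk, evalAt_mk] at this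
  exact RingHom.mem_ker.2 (by rw [map_sub, this, sub_self])

theorem repr_coeffMap {R S W ι : Type*} [CommRing R] [Algebra k R] [CommRing S] [Algebra k S]
    [AddCommGroup W] [Module k W] (b : Module.Basis ι k W) (f : R →ₐ[k] S) (z : R ⊗[k] W) (i : ι) :
    (b.baseChange S).repr (f.toLinearMap.rTensor W z) i = f ((b.baseChange R).repr z i) := by
  induction z with
  | zero => simp
  | add x y hx hy => simp only [map_add, Finsupp.add_apply, hx, hy]
  | tmul a w => simp [Module.Basis.baseChange_repr_tmul]

theorem coordRing_tensor_ext {W : Type u} [AddCommGroup W] [Module k W] [FiniteDimensional k W]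
    {x y : CoordRing p k K ⊗[k] W}
    (h : ∀ (R : CommAlgCat.{u} k) (g : tensorAut p k K R),
      coeffMap W (evalAt R g) x = coeffMap W (evalAt R g) y) : x = y := by
  let b := Module.finBasis k W
  refine (b.baseChange (CoordRing p k K)).repr.injective (Finsupp.ext fun i => ?_)
  refine coordRing_ext fun R g => ?_
  rw [← repr_coeffMap, ← repr_coeffMap, h]

/-- The universal matrix on `rep c`. -/
def univEnd (c : Code p K) (s : Bool) :
    Module.End (CoordRing p k K) (CoordRing p k K ⊗[k] (rep (k := k) c).W) :=
  ((repBasis c).baseChange (CoordRing p k K)).constr (CoordRing p k K) fun j =>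
    ∑ i, Ideal.Quotient.mk (coordIdeal p k K) (MvPolynomial.X ⟨c, s, i, j⟩) ⊗ₜ[k] repBasis c i

theorem univEnd_basis (c : Code p K) (s : Bool) (j) :
    univEnd (k := k) c s (1 ⊗ₜ repBasis c j) =
      ∑ i, Ideal.Quotient.mk (coordIdeal p k K) (MvPolynomial.X ⟨c, s, i, j⟩) ⊗ₜ[k]
        repBasis c i := by
  rw [← Module.Basis.baseChange_apply, univEnd, Module.Basis.constr_basis]

theorem eval_univEnd (c : Code p K) (s : Bool) (R : CommAlgCat.{u} k) (g : tensorAut p k K R)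
    (z : CoordRing p k K ⊗[k] (rep (k := k) c).W) :
    coeffMap _ (evalAt R g) (univEnd c s z) =
      ((signed g s).1 (rep c)).val (coeffMap _ (evalAt R g) z) := by
  suffices h : pushEnd _ (evalAt R g) (univEnd c s) = ((signed g s).1 (rep c)).val by
    rw [← h, pushEnd_coeffMap]
  refine ((repBasis c).baseChange R).ext fun j => ?_
  have e : ((repBasis c).baseChange R) j =
      coeffMap _ (evalAt R g) ((1 : CoordRing p k K) ⊗ₜ repBasis c j) := by
    rw [Module.Basis.baseChange_apply, coeffMap, LinearMap.rTensor_tmul, AlgHom.toLinearMap_apply,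
      map_one]
  rw [e, pushEnd_coeffMap, univEnd_basis, ← e, map_sum,
    ← ((repBasis c).baseChange R).sum_repr (((signed g s).1 (rep c)).val _)]
  refine Finset.sum_congr rfl fun i _ => ?_
  rw [coeffMap, LinearMap.rTensor_tmul, AlgHom.toLinearMap_apply, evalAt_mk, MvPolynomial.aeval_X,
    Module.Basis.baseChange_apply, Module.Basis.baseChange_apply, TensorProduct.smul_tmul',
    smul_eq_mul, mul_one]
  rfl

/-- The universal endomorphism (or its inverse) on the fibre of a triple. -/
def univAt (X : Triple p k K) (s : Bool) :
    Module.End (CoordRing p k K) (CoordRing p k K ⊗[k] X.W) :=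
  (exists_rep X).choose_spec.choose_spec.choose.b.baseChange (CoordRing p k K) ∘ₗ
    univEnd (exists_rep X).choose s ∘ₗ
    (exists_rep X).choose_spec.choose.b.baseChange (CoordRing p k K)

theorem eval_univAt (X : Triple p k K) (s : Bool) (R : CommAlgCat.{u} k) (g : tensorAut p k K R)
    (z : CoordRing p k K ⊗[k] X.W) :
    coeffMap _ (evalAt R g) (univAt X s z) =
      ((signed g s).1 X).val (coeffMap _ (evalAt R g) z) := by
  have h := (exists_rep X).choose_spec.choose_spec.choose_spec.1
  have hg : IsTensorAut p k K R (signed g s).1 := (signed g s).2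
  rw [univAt, LinearMap.comp_apply, LinearMap.comp_apply, coeffMap_baseChange, eval_univEnd,
    coeffMap_baseChange, ← hg.natural]
  generalize coeffMap _ (evalAt R g) z = y
  rw [← LinearMap.comp_apply (LinearMap.baseChange _ _), ← LinearMap.baseChange_comp]
  have e : (exists_rep X).choose_spec.choose_spec.choose.b ∘ₗ (exists_rep X).choose_spec.choose.b =
    LinearMap.id := LinearMap.ext h
  rw [e, LinearMap.baseChange_id]; rfl

variable (p k K) in
/-- The universal tensor automorphism. -/
def univAut : tensorAut p k K (CoordRing p k K) :=
  ⟨fun X =>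
    { val := univAt X true
      inv := univAt X false
      val_inv := LinearMap.ext fun z => coordRing_tensor_ext fun R g => by
        rw [Module.End.mul_apply, eval_univAt, eval_univAt]
        change ((g.1 X) * (g.1 X)⁻¹).val _ = _
        rw [mul_inv_cancel]; rfl
      inv_val := LinearMap.ext fun z => coordRing_tensor_ext fun R g => by
        rw [Module.End.mul_apply, eval_univAt, eval_univAt]
        change ((g.1 X)⁻¹ * (g.1 X)).val _ = _
        rw [inv_mul_cancel]; rfl },
    { natural := fun {X Y} f z => coordRing_tensor_ext fun R g => by
        have hg : IsTensorAut p k K R (signed g true).1 := (signed g true).2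
        rw [eval_univAt, coeffMap_baseChange, coeffMap_baseChange, eval_univAt, hg.natural]
      tensor := fun X Y z z' => coordRing_tensor_ext fun R g => by
        have hg : IsTensorAut p k K R (signed g true).1 := (signed g true).2
        rw [eval_univAt, coeffMap_tensorIso, coeffMap_tensorIso, eval_univAt, eval_univAt,
          hg.tensor]
      unit := fun z => coordRing_tensor_ext fun R g => by
        have hg : IsTensorAut p k K R (signed g true).1 := (signed g true).2
        rw [eval_univAt, hg.unit] }⟩

theorem map_evalAt (R : CommAlgCat.{u} k) (g : tensorAut p k K R) :
    tensorAutMap p k K (evalAt R g) (univAut p k K) = g := by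
  refine Subtype.ext (funext fun X => Units.ext ?_)
  refine end_ext_coeffMap X.W (evalAt R g) fun z => ?_
  exact (coeffMap_units (evalAt R g) X.W _ z).trans (eval_univAt X true R g z)

theorem univAut_signed (c : Code p K) (s : Bool) :
    ((signed (univAut p k K) s).1 (rep c)).val = univEnd c s := by
  refine LinearMap.ext fun z => coordRing_tensor_ext fun R g => ?_
  rw [eval_univEnd, ← eval_univAt]
  cases s <;> rfl

theorem evalAt_map (R : CommAlgCat.{u} k) (f : CoordRing p k K →ₐ[k] R) :
    evalAt R (tensorAutMap p k K f (univAut p k K)) = f := by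
  refine Ideal.Quotient.algHom_ext _ (MvPolynomial.algHom_ext fun x => ?_)
  obtain ⟨c, s, i, j⟩ := x
  change MvPolynomial.aeval (R := k) (point _) (MvPolynomial.X _) = f (Ideal.Quotient.mk _ _)
  rw [MvPolynomial.aeval_X, point]
  have e1 : signed (tensorAutMap p k K f (univAut p k K)) s =
      tensorAutMap p k K f (signed (univAut p k K) s) := by
    cases s
    · exact (map_inv _ _).symm
    · rfl
  have e2 : (1 : R) ⊗ₜ[k] repBasis c j =
      coeffMap _ f ((1 : CoordRing p k K) ⊗ₜ repBasis c j) := by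
    rw [coeffMap, LinearMap.rTensor_tmul, AlgHom.toLinearMap_apply, map_one]
  have e3 := coeffMap_units f _ ((signed (univAut p k K) s).1 (rep c)) (1 ⊗ₜ repBasis c j)
  rw [univAut_signed, univEnd_basis] at e3
  dsimp only
  rw [e1, e2]
  refine (congrArg (fun y => ((repBasis c).baseChange R).repr y i) e3).trans ?_
  refine (repr_coeffMap (repBasis c) f _ i).trans (congrArg f ?_)
  rw [map_sum, Finset.sum_apply']
  simp [Module.Basis.baseChange_repr_tmul, Finsupp.single_apply]

variable (p k K) in
/-- The functor of tensor automorphisms is represented by the coordinate ring. -/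
def autRepresentable : (autFunctor p k K ⋙ forget GrpCat).CorepresentableBy
    (CommAlgCat.of k (CoordRing p k K)) where
  homEquiv {R} :=
    { toFun := fun f => tensorAutMap p k K f.hom (univAut p k K)
      invFun := fun g => CommAlgCat.ofHom (evalAt R g)
      left_inv := fun f => CommAlgCat.hom_ext (evalAt_map R f.hom)
      right_inv := fun g => map_evalAt R g }
  homEquiv_comp {R S} g f := by
    have := (autFunctor p k K).map_comp f g
    exact congrArg (fun h => h.hom (univAut p k K)) this

end Representable

/-! ### Affine group schemes -/

section GroupSchemes

variable (k : Type u) [Field k]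

/-- Affine group schemes over `k`: the functors from `k`-algebras to groups that are represented
by a `k`-algebra. (The values may be large, the representing algebra is small.) -/
abbrev AffineGroupScheme : Type (u + 2) :=
  ObjectProperty.FullSubcategory (C := CommAlgCat.{u} k ⥤ GrpCat.{u + 1}) fun G =>
    ∃ A : CommAlgCat.{u} k, Nonempty ((G ⋙ forget GrpCat).CorepresentableBy A)

variable {k}

/-- The `R`-valued points of an affine group scheme. -/
abbrev AffineGroupScheme.points (G : AffineGroupScheme k) (R : CommAlgCat.{u} k) :
    GrpCat.{u + 1} :=
  G.obj.obj R

/-- The algebra `A` is a coordinate ring of `G`. -/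
abbrev AffineGroupScheme.CoordinateRing (G : AffineGroupScheme k) (A : CommAlgCat.{u} k) :
    Type (u + 1) :=
  (G.obj ⋙ forget GrpCat).CorepresentableBy A

/-- The effect on `R`-valued points of a homomorphism of affine group schemes. -/
abbrev AffineGroupScheme.onPoints {G H : AffineGroupScheme k} (φ : G ⟶ H)
    (R : CommAlgCat.{u} k) : G.points R →* H.points R :=
  (φ.hom.app R).hom

/-- The homomorphism of coordinate rings attached to a homomorphism of affine group schemes:
the one that corresponds to the image of the universal point of `G`. -/
def AffineGroupScheme.comorphism {G H : AffineGroupScheme k} (φ : G ⟶ H)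
    {A B : CommAlgCat.{u} k} (a : G.CoordinateRing A) (b : H.CoordinateRing B) : B ⟶ A :=
  b.homEquiv.symm (AffineGroupScheme.onPoints φ A (a.homEquiv (𝟙 A)))

/-- A homomorphism of affine group schemes is a closed immersion if the homomorphism of
coordinate rings is surjective. -/
def AffineGroupScheme.IsClosedImmersion {G H : AffineGroupScheme k} (φ : G ⟶ H) : Prop :=
  ∀ (A B : CommAlgCat.{u} k) (a : G.CoordinateRing A) (b : H.CoordinateRing B),
    Function.Surjective (AffineGroupScheme.comorphism φ a b).hom

/-- Closed subgroup schemes of `G`: subgroups of `G(R)` for all `R`, functorial in `R`, which are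
cut out by an ideal of the coordinate ring. -/
@[ext]
structure AffineGroupScheme.ClosedSubgroup (G : AffineGroupScheme k) where
  carrier : ∀ R : CommAlgCat.{u} k, Subgroup (G.points R)
  map_mem : ∀ {R S : CommAlgCat.{u} k} (f : R ⟶ S) (g : G.points R), g ∈ carrier R →
    (G.obj.map f).hom g ∈ carrier S
  closed : ∀ (A : CommAlgCat.{u} k) (a : G.CoordinateRing A), ∃ I : Ideal A,
    ∀ (R : CommAlgCat.{u} k) (f : A ⟶ R), a.homEquiv f ∈ carrier R ↔ ∀ x ∈ I, f.hom x = 0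

/-- Closed subgroup schemes are ordered by inclusion. -/
instance (G : AffineGroupScheme k) : PartialOrder G.ClosedSubgroup where
  le H H' := ∀ R, H.carrier R ≤ H'.carrier R
  le_refl _ _ := le_rfl
  le_trans _ _ _ h h' R := (h R).trans (h' R)
  le_antisymm _ _ h h' :=
    AffineGroupScheme.ClosedSubgroup.ext (funext fun R => (h R).antisymm (h' R))

end GroupSchemes

/-! ### The local Nori fundamental group -/

section PiL

variable (p : ℕ) [Fact p.Prime]

/-- The local Nori fundamental group of `K/k`: the group scheme of tensor automorphisms of the
fibre functor `(V, W, ψ) ↦ W` on the category of triples. -/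
def piL (k K : Type u) [Field k] [Field K] [CharP K p] [Algebra k K] : AffineGroupScheme k :=
  ⟨autFunctor p k K, _, ⟨autRepresentable p k K⟩⟩

/-- The homomorphism of local Nori fundamental groups induced by a homomorphism of extensions
of `k`: restriction of tensor automorphisms along the pullback of triples. -/
def piLMap {k K L : Type u} [Field k] [Field K] [Field L] [CharP K p] [CharP L p] [Algebra k K]
    [Algebra k L] (f : K →ₐ[k] L) : piL p k L ⟶ piL p k K :=
  ObjectProperty.homMk
    { app := fun R => GrpCat.ofHom (res p f R)
      naturality := fun _ _ _ => rfl }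

theorem piLMap_id {k K : Type u} [Field k] [Field K] [CharP K p] [Algebra k K] :
    piLMap p (AlgHom.id k K) = 𝟙 (piL p k K) :=
  ObjectProperty.hom_ext _ (NatTrans.ext (funext fun R =>
    GrpCat.hom_ext (MonoidHom.ext fun g => res_id R g)))

theorem piLMap_comp {k K L M : Type u} [Field k] [Field K] [Field L] [Field M] [CharP K p]
    [CharP L p] [CharP M p] [Algebra k K] [Algebra k L] [Algebra k M]
    (g : L →ₐ[k] M) (f : K →ₐ[k] L) : piLMap p (g.comp f) = piLMap p g ≫ piLMap p f :=
  ObjectProperty.hom_ext _ (NatTrans.ext (funext fun R =>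
    GrpCat.hom_ext (MonoidHom.ext fun t => res_comp g f R t)))

end PiL

/-! ### Purely inseparable extensions -/

section PI

variable (k K : Type u) [Field k] [Field K] [Algebra k K]

/-- Purely inseparable extensions of `K`, with the `k`-algebra structure induced from `K`. -/
structure PI where
  carrier : Type u
  [field : Field carrier]
  [algebra : Algebra K carrier]
  [algebraBase : Algebra k carrier]
  [tower : IsScalarTower k K carrier]
  [purelyInseparable : IsPurelyInseparable K carrier]

variable {k K}

instance : CoeSort (PI k K) (Type u) := ⟨PI.carrier⟩

attribute [instance] PI.field PI.algebra PI.algebraBase PI.tower PI.purelyInseparable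

/-- The morphisms are the homomorphisms of extensions of `K`. -/
instance : Category (PI k K) where
  Hom L M := L →ₐ[K] M
  id L := AlgHom.id K L
  comp f g := g.comp f

instance : Quiver.IsThin (PI k K) := fun L M =>
  inferInstanceAs (Subsingleton (L →ₐ[K] M))

instance (p : ℕ) [CharP K p] (L : PI k K) : CharP L p :=
  charP_of_injective_algebraMap (algebraMap K L).injective p

/-- A homomorphism of extensions of `K`, as a homomorphism of extensions of `k`. -/
def PI.homBase {L M : PI k K} (f : L ⟶ M) : L →ₐ[k] M :=
  AlgHom.restrictScalars k (S := K) f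

theorem PI.homBase_id (L : PI k K) : PI.homBase (𝟙 L) = AlgHom.id k L := rfl

theorem PI.homBase_comp {L M N : PI k K} (f : L ⟶ M) (g : M ⟶ N) :
    PI.homBase (f ≫ g) = (PI.homBase g).comp (PI.homBase f) := rfl

theorem PI.homBase_comp_toAlgHom {L M : PI k K} (f : L ⟶ M) :
    (PI.homBase f).comp (IsScalarTower.toAlgHom k K L) = IsScalarTower.toAlgHom k K M :=
  AlgHom.ext fun x => AlgHom.commutes (R := K) f x

variable (p : ℕ) [Fact p.Prime] [CharP K p]

/-- The homomorphism `π(L/k) → π(K/k)` attached to a purely inseparable extension `L/K`. -/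
def PI.toBase (L : PI k K) : piL p k L ⟶ piL p k K :=
  piLMap p (IsScalarTower.toAlgHom k K L)

theorem PI.map_toBase {L M : PI k K} (f : L ⟶ M) :
    piLMap p (PI.homBase f) ≫ L.toBase p = M.toBase p := by
  rw [PI.toBase, PI.toBase, ← piLMap_comp, PI.homBase_comp_toAlgHom]

variable (k K)

/-- The contravariant functor `L ↦ (π(L/k) → π(K/k))` from purely inseparable extensions of `K`
to affine group schemes over `π(K/k)`. -/
def piFunctor : (PI k K)ᵒᵖ ⥤ Over (piL p k K) where
  obj L := Over.mk (L.unop.toBase p)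
  map f := Over.homMk (piLMap p (PI.homBase f.unop)) (PI.map_toBase p f.unop)
  map_id L := Over.OverMorphism.ext (piLMap_id (k := k) (K := L.unop) p)
  map_comp f g := Over.OverMorphism.ext
    (piLMap_comp p (PI.homBase f.unop) (PI.homBase g.unop))

end PI

end LocalNori

end

/-!
A purely inseparable extension `L/K` has the same perfect closure as `K`. Hence a triple over `L`,
written in a basis of its first component, is a quotient of the pullback of a triple over `K`: keep
`W` and `ψ`, and replace `V` by `Kⁿ`. So every matrix coefficient over `L` comes from a matrix
coefficient over `K`, and `π(L/k) → π(K/k)` is a closed immersion.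

The image of `π(L/k)` determines `L` inside `K^perf`. For `t` in `K^perf`, let `X` be the
self-extension of the unit triple given by the unipotent matrix with entry `t`, and pull it back
to `L`. If `t` lies in `L`, the extension splits and all of `π(L/k)` fixes the second basis vector
of its fibre. Conversely, the two extensions of `ψ` to `L^perf ⊗_L L^perf` differ by a point of
`π(L/k)`, which moves this vector by `t ⊗ 1 - 1 ⊗ t`; if the vector is fixed, then `t` lies in `L`.
Fullness follows, because a closed immersion is a monomorphism.
-/

noncomputable section

namespace LocalNori

/-! ### Comparing two extensions of `ψ` -/

section Extend

variable {p : ℕ} [Fact p.Prime] {k K : Type u} [Field k] [Field K] [CharP K p] [Algebra k K]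
  {S : Type u} [CommRing S] [Algebra k S] [Algebra K S] [IsScalarTower k K S]

/-- The extension of `ψ` along a homomorphism `q : K^perf → S` of `K`-algebras. -/
def Triple.extend (q : PerfectClosure K p →ₐ[K] S) (X : Triple p k K) :
    S ⊗[K] X.V ≃ₗ[S] S ⊗[k] X.W :=
  letI : Algebra (PerfectClosure K p) S := q.toRingHom.toAlgebra
  haveI : IsScalarTower K (PerfectClosure K p) S :=
    IsScalarTower.of_algebraMap_eq fun x => (q.commutes x).symm
  haveI : IsScalarTower k (PerfectClosure K p) S :=
    IsScalarTower.of_algebraMap_eq fun x => ((q.restrictScalars k).commutes x).symm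
  (AlgebraTensorModule.cancelBaseChange K (PerfectClosure K p) S S X.V).symm ≪≫ₗ
  X.ψ.baseChange (PerfectClosure K p) S _ _ ≪≫ₗ
  AlgebraTensorModule.cancelBaseChange k (PerfectClosure K p) S S X.W

theorem Triple.extend_one_tmul (q : PerfectClosure K p →ₐ[K] S) (X : Triple p k K) (v : X.V) :
    X.extend q (1 ⊗ₜ v) = coeffMap X.W (q.restrictScalars k) (X.ψ (1 ⊗ₜ v)) := by
  let _ : Algebra (PerfectClosure K p) S := q.toRingHom.toAlgebra
  simp only [extend, LinearEquiv.trans_apply, AlgebraTensorModule.cancelBaseChange_symm_tmul,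
    LinearEquiv.baseChange_tmul]
  generalize X.ψ (1 ⊗ₜ v) = z
  induction z with
  | zero => simp
  | add x y hx hy => simp only [map_add, TensorProduct.tmul_add, hx, hy]
  | tmul c w =>
    rw [AlgebraTensorModule.cancelBaseChange_tmul, Algebra.smul_def, mul_one]
    rfl

theorem Triple.extend_coeffMap (q : PerfectClosure K p →ₐ[K] S) (X : Triple p k K)
    (z : PerfectClosure K p ⊗[K] X.V) :
    X.extend q (coeffMap X.V q z) = coeffMap X.W (q.restrictScalars k) (X.ψ z) := by
  induction z with
  | zero => simp only [map_zero]
  | add x y hx hy => simp only [map_add, hx, hy]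
  | tmul c v =>
    rw [TensorProduct.tmul_eq_smul_one_tmul, coeffMap_smul, map_smul, map_smul, coeffMap_smul,
      LinearMap.rTensor_tmul, AlgHom.toLinearMap_apply, map_one, extend_one_tmul,
      AlgHom.restrictScalars_apply]

theorem Triple.extend_baseChange (q : PerfectClosure K p →ₐ[K] S) {X Y : Triple p k K}
    (f : X ⟶ Y) (z : S ⊗[K] X.V) :
    Y.extend q (f.a.baseChange S z) = f.b.baseChange S (X.extend q z) := by
  suffices h : (Y.extend q).toLinearMap ∘ₗ f.a.baseChange S =
      f.b.baseChange S ∘ₗ (X.extend q).toLinearMap from LinearMap.congr_fun h z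
  refine end_ext_coeffMap X.V q fun z => ?_
  simp only [LinearMap.comp_apply, LinearEquiv.coe_coe, ← coeffMap_baseChange, extend_coeffMap,
    f.comm]

theorem Triple.extend_symm_baseChange (q : PerfectClosure K p →ₐ[K] S) {X Y : Triple p k K}
    (f : X ⟶ Y) (z : S ⊗[k] X.W) :
    (Y.extend q).symm (f.b.baseChange S z) = f.a.baseChange S ((X.extend q).symm z) := by
  rw [LinearEquiv.symm_apply_eq, extend_baseChange, LinearEquiv.apply_symm_apply]

/-- The canonical isomorphism `(S ⊗ V) ⊗_S (S ⊗ V') ≃ S ⊗ (V ⊗ V')` for the first components of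
two triples; see `tensorIso` for the second components. -/
def tensorIsoV (S : Type u) [CommRing S] [Algebra K S] (X Y : Triple p k K) :
    (S ⊗[K] X.V) ⊗[S] (S ⊗[K] Y.V) ≃ₗ[S] S ⊗[K] (X.tensor Y).V :=
  (AlgebraTensorModule.distribBaseChange K S X.V Y.V).symm

theorem Triple.tensor_ψ_tensorIsoV (X Y : Triple p k K) (z : PerfectClosure K p ⊗[K] X.V)
    (z' : PerfectClosure K p ⊗[K] Y.V) :
    (X.tensor Y).ψ (tensorIsoV _ X Y (z ⊗ₜ z')) = tensorIso _ X Y (X.ψ z ⊗ₜ Y.ψ z') :=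
  congrArg (fun t => tensorIso _ X Y (TensorProduct.congr X.ψ Y.ψ t))
    ((AlgebraTensorModule.distribBaseChange K (PerfectClosure K p) X.V Y.V).apply_symm_apply
      (z ⊗ₜ z'))

theorem Triple.extend_tensorIsoV (q : PerfectClosure K p →ₐ[K] S) (X Y : Triple p k K)
    (z : S ⊗[K] X.V) (z' : S ⊗[K] Y.V) :
    (X.tensor Y).extend q (tensorIsoV S X Y (z ⊗ₜ z')) =
      tensorIso S X Y (X.extend q z ⊗ₜ Y.extend q z') := by
  induction z with
  | zero => simp only [map_zero, TensorProduct.zero_tmul]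
  | add x y hx hy => simp only [map_add, TensorProduct.add_tmul, hx, hy]
  | tmul c v =>
    induction z' with
    | zero => simp only [map_zero, TensorProduct.tmul_zero]
    | add x y hx hy => simp only [map_add, TensorProduct.tmul_add, hx, hy]
    | tmul c' v' =>
      have on_one : tensorIsoV S X Y ((1 ⊗ₜ v) ⊗ₜ (1 ⊗ₜ v')) =
          coeffMap (X.tensor Y).V q (tensorIsoV _ X Y ((1 ⊗ₜ v) ⊗ₜ (1 ⊗ₜ v'))) := by
        refine Eq.trans ?_ (coeffMap_distrib q (1 ⊗ₜ v) (1 ⊗ₜ v')).symm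
        simp only [LinearMap.rTensor_tmul, AlgHom.toLinearMap_apply, map_one]
        rfl
      rw [TensorProduct.tmul_eq_smul_one_tmul c v, TensorProduct.tmul_eq_smul_one_tmul c' v']
      simp only [TensorProduct.smul_tmul_smul, map_smul]
      rw [on_one, extend_coeffMap, tensor_ψ_tensorIsoV, coeffMap_tensorIso, extend_one_tmul,
        extend_one_tmul]

theorem Triple.extend_symm_tensorIso (q : PerfectClosure K p →ₐ[K] S) (X Y : Triple p k K)
    (z : S ⊗[k] X.W) (z' : S ⊗[k] Y.W) :
    ((X.tensor Y).extend q).symm (tensorIso S X Y (z ⊗ₜ z')) =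
      tensorIsoV S X Y ((X.extend q).symm z ⊗ₜ (Y.extend q).symm z') := by
  rw [LinearEquiv.symm_apply_eq, extend_tensorIsoV, LinearEquiv.apply_symm_apply,
    LinearEquiv.apply_symm_apply]

theorem Triple.unit_ψ_one_tmul (c : K) :
    (Triple.unit p k K).ψ (1 ⊗ₜ c) = PerfectClosure.of K p c ⊗ₜ (1 : k) := by
  change (AlgebraTensorModule.rid k (PerfectClosure K p) (PerfectClosure K p)).symm
    (AlgebraTensorModule.rid K (PerfectClosure K p) (PerfectClosure K p) (1 ⊗ₜ c)) = _
  rw [AlgebraTensorModule.rid_tmul, AlgebraTensorModule.rid_symm_apply, Algebra.smul_def, mul_one]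
  rfl

theorem Triple.extend_unit_one_tmul (q : PerfectClosure K p →ₐ[K] S) (c : K) :
    (Triple.unit p k K).extend q (1 ⊗ₜ c) = algebraMap K S c ⊗ₜ (1 : k) :=
  ((extend_one_tmul q (Triple.unit p k K) c).trans (congrArg _ (unit_ψ_one_tmul c))).trans
    (congrArg (· ⊗ₜ[k] (1 : k)) (q.commutes c))

theorem Triple.extend_unit_eq (q q' : PerfectClosure K p →ₐ[K] S) :
    (Triple.unit p k K).extend q = (Triple.unit p k K).extend q' :=
  LinearEquiv.toLinearMap_injective <|
    (TensorProduct.isBaseChange K (Triple.unit p k K).V S).algHom_ext _ _ fun c =>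
      (extend_unit_one_tmul q c).trans (extend_unit_one_tmul q' c).symm

/-- The tensor automorphism over `S` that compares the extensions of `ψ` along two homomorphisms
`q, q' : K^perf → S` of `K`-algebras. -/
def descentAut (q q' : PerfectClosure K p →ₐ[K] S) : tensorAut p k K S :=
  ⟨fun X => (LinearMap.GeneralLinearGroup.generalLinearEquiv S (S ⊗[k] X.W)).symm
      ((X.extend q').symm ≪≫ₗ X.extend q),
    { natural := fun {X Y} f z => by
        change Y.extend q ((Y.extend q').symm _) =
          f.b.baseChange S (X.extend q ((X.extend q').symm z))
        rw [Triple.extend_symm_baseChange, Triple.extend_baseChange]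
      tensor := fun X Y z z' => by
        change (X.tensor Y).extend q (((X.tensor Y).extend q').symm _) =
          tensorIso S X Y (X.extend q ((X.extend q').symm z) ⊗ₜ
            Y.extend q ((Y.extend q').symm z'))
        rw [Triple.extend_symm_tensorIso, Triple.extend_tensorIsoV]
      unit := fun z => by
        change (Triple.unit p k K).extend q (((Triple.unit p k K).extend q').symm z) = z
        rw [Triple.extend_unit_eq q q', LinearEquiv.apply_symm_apply] }⟩

theorem descentAut_extend (q q' : PerfectClosure K p →ₐ[K] S) (X : Triple p k K)
    (z : S ⊗[K] X.V) :
    ((descentAut q q').1 X).val (X.extend q' z) = X.extend q z :=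
  congrArg (X.extend q) ((X.extend q').symm_apply_apply z)

end Extend

/-! ### Self-extensions of the unit triple -/

section Unipotent

variable {p : ℕ} [Fact p.Prime] {k K : Type u} [Field k] [Field K] [CharP K p] [Algebra k K]

/-- The morphism from the unit triple to `(V, W, ψ)` given by two vectors of `V` and `W` that `ψ`
identifies. -/
def Triple.homOfUnit {X : Triple p k K} (v : X.V) (w : X.W) (h : X.ψ (1 ⊗ₜ v) = 1 ⊗ₜ w) :
    Triple.unit p k K ⟶ X where
  a := LinearMap.toSpanSingleton K X.V v
  b := LinearMap.toSpanSingleton k X.W w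
  comm z := by
    suffices e : X.ψ.toLinearMap ∘ₗ
          (LinearMap.toSpanSingleton K X.V v).baseChange (PerfectClosure K p) =
        (LinearMap.toSpanSingleton k X.W w).baseChange (PerfectClosure K p) ∘ₗ
          (Triple.unit p k K).ψ.toLinearMap from LinearMap.congr_fun e z
    refine (TensorProduct.isBaseChange K K (PerfectClosure K p)).algHom_ext _ _ fun c => ?_
    have right : (LinearMap.toSpanSingleton k X.W w).baseChange (PerfectClosure K p)
        ((Triple.unit p k K).ψ (1 ⊗ₜ c)) = PerfectClosure.of K p c ⊗ₜ w :=
      (congrArg _ (unit_ψ_one_tmul c)).trans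
        ((LinearMap.baseChange_tmul ..).trans (congrArg _ (one_smul k w)))
    refine Eq.trans ?_ right.symm
    change X.ψ (1 ⊗ₜ[K] (c • v)) = _
    rw [TensorProduct.tmul_smul, ← algebraMap_smul (PerfectClosure K p) c, map_smul, h,
      ← TensorProduct.tmul_eq_smul_one_tmul]
    rfl

theorem IsTensorAut.fixed {R : Type u} [CommRing R] [Algebra k R]
    {g : ∀ X : Triple p k K, (Module.End R (R ⊗[k] X.W))ˣ} (hg : IsTensorAut p k K R g)
    {X : Triple p k K} {v : X.V} {w : X.W} (h : X.ψ (1 ⊗ₜ v) = 1 ⊗ₜ w) :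
    (g X).val (1 ⊗ₜ w) = 1 ⊗ₜ w := by
  have image_one : (Triple.homOfUnit v w h).b.baseChange R (1 ⊗ₜ (1 : k)) = 1 ⊗ₜ w :=
    (LinearMap.baseChange_tmul ..).trans (congrArg _ (one_smul k w))
  have natural := hg.natural (Triple.homOfUnit v w h) (1 ⊗ₜ (1 : k))
  rw [hg.unit] at natural
  rwa [image_one] at natural

/-- Vectors of `V` and `W` that exhibit a self-extension of the unit triple inside `(V, W, ψ)`,
of class `t` modulo `K`. -/
structure Triple.UnipotentFrame (X : Triple p k K) (t : PerfectClosure K p) where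
  v₀ : X.V
  v₁ : X.V
  w₀ : X.W
  w₁ : X.W
  w₀_ne_zero : w₀ ≠ 0
  ψ_v₀ : X.ψ (1 ⊗ₜ v₀) = 1 ⊗ₜ w₀
  ψ_v₁ : X.ψ (1 ⊗ₜ v₁) = 1 ⊗ₜ w₁ + t ⊗ₜ w₀

theorem tmul_left_injective_of_ne_zero (S : Type*) [CommRing S] [Algebra k S] {W : Type*}
    [AddCommGroup W] [Module k W] {w : W} (hw : w ≠ 0) :
    Function.Injective fun s : S => s ⊗ₜ[k] w := by
  obtain ⟨φ, hφ⟩ := Module.Projective.exists_dual_eq_one k hw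
  have left_inverse (s : S) : φ.baseChange S (s ⊗ₜ w) = s := by
    rw [Module.Dual.baseChange_apply_tmul, hφ, one_smul]
  exact Function.LeftInverse.injective left_inverse

namespace Triple.UnipotentFrame

theorem descentAut_w₁ {S : Type u} [CommRing S] [Algebra k S] [Algebra K S] [IsScalarTower k K S]
    {X : Triple p k K} {t : PerfectClosure K p} (F : X.UnipotentFrame t)
    (q q' : PerfectClosure K p →ₐ[K] S) :
    ((descentAut (k := k) q q').1 X).val (1 ⊗ₜ F.w₁) = 1 ⊗ₜ F.w₁ + (q t - q' t) ⊗ₜ F.w₀ := by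
  have extend_v₁ (r : PerfectClosure K p →ₐ[K] S) :
      X.extend r (1 ⊗ₜ F.v₁) = 1 ⊗ₜ F.w₁ + r t ⊗ₜ F.w₀ := by
    rw [Triple.extend_one_tmul, F.ψ_v₁, map_add, LinearMap.rTensor_tmul, LinearMap.rTensor_tmul,
      AlgHom.toLinearMap_apply, map_one, AlgHom.toLinearMap_apply, AlgHom.restrictScalars_apply]
  have fixed_w₀ : ((descentAut (k := k) q q').1 X).val (1 ⊗ₜ F.w₀) = 1 ⊗ₜ F.w₀ :=
    IsTensorAut.fixed (descentAut q q').2 F.ψ_v₀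
  have image_v₁ := descentAut_extend q q' X (1 ⊗ₜ F.v₁)
  rw [extend_v₁, extend_v₁, map_add, TensorProduct.tmul_eq_smul_one_tmul (q' t), map_smul,
    fixed_w₀, ← TensorProduct.tmul_eq_smul_one_tmul] at image_v₁
  rw [TensorProduct.sub_tmul, ← add_sub_assoc, ← image_v₁, add_sub_cancel_right]

theorem fixed_w₁ {R : Type u} [CommRing R] [Algebra k R]
    {g : ∀ X : Triple p k K, (Module.End R (R ⊗[k] X.W))ˣ} (hg : IsTensorAut p k K R g)
    {X : Triple p k K} {x : K} (F : X.UnipotentFrame (PerfectClosure.of K p x)) :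
    (g X).val (1 ⊗ₜ F.w₁) = 1 ⊗ₜ F.w₁ :=
  hg.fixed (v := F.v₁ - x • F.v₀) <| by
    rw [TensorProduct.tmul_sub, map_sub, TensorProduct.tmul_smul,
      ← algebraMap_smul (PerfectClosure K p) x, map_smul, F.ψ_v₀, F.ψ_v₁,
      ← TensorProduct.tmul_eq_smul_one_tmul]
    exact add_sub_cancel_right _ _

theorem mem_range_iff {X : Triple p k K} {t : PerfectClosure K p} (F : X.UnipotentFrame t) :
    t ∈ (PerfectClosure.of K p).range ↔ ∀ (R : Type u) [CommRing R] [Algebra k R],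
      ∀ g ∈ tensorAut p k K R, (g X).val (1 ⊗ₜ F.w₁) = 1 ⊗ₜ F.w₁ := by
  refine ⟨?_, fun h => ?_⟩
  · rintro ⟨x, rfl⟩ R _ _ g hg
    exact F.fixed_w₁ hg
  · let P := PerfectClosure K p
    let q : P →ₐ[K] P ⊗[K] P := Algebra.TensorProduct.includeLeft
    let q' : P →ₐ[K] P ⊗[K] P := Algebra.TensorProduct.includeRight
    have fixed := h (P ⊗[K] P) _ (descentAut q q').2
    rw [F.descentAut_w₁, add_eq_left] at fixed
    have eq_zero : q t - q' t = 0 :=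
      tmul_left_injective_of_ne_zero (k := k) _ F.w₀_ne_zero (by simpa using fixed)
    exact (Algebra.IsEffective.of_faithfullyFlat K P t).1 eq_zero

end Triple.UnipotentFrame

end Unipotent

/-! ### Triples given by bases -/

section OfBasis

variable {p : ℕ} [Fact p.Prime] {k K L : Type u} [Field k] [Field K] [Field L] [CharP K p]
  [CharP L p] [Algebra k K] [Algebra k L]

/-- The triple `(Kⁿ, W, ψ)` in which `ψ` maps the standard basis to a given basis of
`K^perf ⊗ W`. -/
def Triple.ofBasis (W : Type u) [AddCommGroup W] [Module k W] [FiniteDimensional k W] {n : ℕ}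
    (B : Module.Basis (Fin n) (PerfectClosure K p) (PerfectClosure K p ⊗[k] W)) :
    Triple p k K where
  V := Fin n → K
  W := W
  ψ := ((Pi.basisFun K (Fin n)).baseChange (PerfectClosure K p)).equivFun ≪≫ₗ B.equivFun.symm

theorem Triple.ofBasis_ψ_one_tmul (W : Type u) [AddCommGroup W] [Module k W]
    [FiniteDimensional k W] {n : ℕ}
    (B : Module.Basis (Fin n) (PerfectClosure K p) (PerfectClosure K p ⊗[k] W)) (v : Fin n → K) :
    (Triple.ofBasis W B).ψ (1 ⊗ₜ v) = ∑ j, PerfectClosure.of K p (v j) • B j := by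
  change B.equivFun.symm
    (((Pi.basisFun K (Fin n)).baseChange (PerfectClosure K p)).equivFun (1 ⊗ₜ v)) = _
  simp only [Module.Basis.equivFun_symm_apply, Module.Basis.equivFun_apply,
    Module.Basis.baseChange_repr_tmul, Pi.basisFun_repr, Algebra.smul_def, mul_one]
  rfl

theorem Triple.ofBasis_ψ_single (W : Type u) [AddCommGroup W] [Module k W]
    [FiniteDimensional k W] {n : ℕ}
    (B : Module.Basis (Fin n) (PerfectClosure K p) (PerfectClosure K p ⊗[k] W)) (j : Fin n) :
    (Triple.ofBasis W B).ψ (1 ⊗ₜ (Pi.single j 1 : Fin n → K)) = B j := by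
  refine (Triple.ofBasis_ψ_one_tmul W B _).trans ?_
  simp only [Pi.single_apply, apply_ite (PerfectClosure.of K p), map_one, map_zero, ite_smul,
    one_smul, zero_smul, Finset.sum_ite_eq', Finset.mem_univ, if_true]
  rfl

/-- The triple `(K², k², ψ)` in which `ψ` is the unipotent matrix with upper right entry `t`. -/
def Triple.unipotent (k : Type u) [Field k] [Algebra k K] (t : PerfectClosure K p) :
    Triple p k K :=
  Triple.ofBasis (k × k) <| ((Module.Basis.finTwoProd k).baseChange (PerfectClosure K p)).map <|
    LinearEquiv.transvection (f := Module.Dual.baseChange _ (LinearMap.snd k k k))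
      (v := t ⊗ₜ ((1, 0) : k × k)) (by
        rw [Module.Dual.baseChange_apply_tmul, LinearMap.snd_apply, zero_smul])

variable (k) in
/-- The standard frame of the unipotent triple: the standard bases of `K²` and `k²`. -/
def Triple.unipotentFrame (t : PerfectClosure K p) : (Triple.unipotent k t).UnipotentFrame t where
  v₀ := (Pi.single 0 1 : Fin 2 → K)
  v₁ := (Pi.single 1 1 : Fin 2 → K)
  w₀ := ((1, 0) : k × k)
  w₁ := ((0, 1) : k × k)
  w₀_ne_zero := fun h => one_ne_zero (congrArg Prod.fst h)
  ψ_v₀ := by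
    refine (Triple.ofBasis_ψ_single ..).trans ?_
    rw [Module.Basis.map_apply, Module.Basis.baseChange_apply, Module.Basis.finTwoProd_zero,
      LinearEquiv.transvection.apply, Module.Dual.baseChange_apply_tmul, LinearMap.snd_apply,
      zero_smul, zero_smul, add_zero]
    rfl
  ψ_v₁ := by
    refine (Triple.ofBasis_ψ_single ..).trans ?_
    rw [Module.Basis.map_apply, Module.Basis.baseChange_apply, Module.Basis.finTwoProd_one,
      LinearEquiv.transvection.apply, Module.Dual.baseChange_apply_tmul, LinearMap.snd_apply,
      one_smul, one_smul]
    rfl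

/-- The frame of the pullback along `f` induced by a frame of class `t`; its class is the image of
`t`. -/
def Triple.UnipotentFrame.pullback (f : K →ₐ[k] L) {X : Triple p k K} {t : PerfectClosure K p}
    (F : X.UnipotentFrame t) : (X.pullback f).UnipotentFrame (perfMap p f t) where
  v₀ := (SemiHom.toPullback f X).a F.v₀
  v₁ := (SemiHom.toPullback f X).a F.v₁
  w₀ := (SemiHom.toPullback f X).b F.w₀
  w₁ := (SemiHom.toPullback f X).b F.w₁
  w₀_ne_zero := F.w₀_ne_zero
  ψ_v₀ := by
    rw [(SemiHom.toPullback f X).comm, F.ψ_v₀, TensorProduct.map_tmul, AlgHom.toLinearMap_apply,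
      map_one]
  ψ_v₁ := by
    rw [(SemiHom.toPullback f X).comm, F.ψ_v₁, map_add, TensorProduct.map_tmul,
      TensorProduct.map_tmul, AlgHom.toLinearMap_apply, AlgHom.toLinearMap_apply, map_one]

theorem exists_basis_coeffMap_eq {R S : Type u} [CommRing R] [CommRing S] [Algebra k R]
    [Algebra k S] (e : R ≃ₐ[k] S) {W : Type u} [AddCommGroup W] [Module k W] {ι : Type*}
    (B : Module.Basis ι S (S ⊗[k] W)) :
    ∃ B' : Module.Basis ι R (R ⊗[k] W), ∀ j, coeffMap W e (B' j) = B j := by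
  let _ : Module R (S ⊗[k] W) := Module.compHom _ (e : R →+* S)
  let E₀ : R ⊗[k] W ≃ₗ[k] S ⊗[k] W := LinearEquiv.rTensor W e.toLinearEquiv
  let E : R ⊗[k] W ≃ₗ[R] S ⊗[k] W :=
    { E₀ with map_smul' := fun c z => coeffMap_smul W (e : R →ₐ[k] S) c z }
  have smul_eq (c : S) (z : S ⊗[k] W) : e.symm.toRingEquiv c • z = c • z := by
    change e (e.symm c) • z = c • z
    rw [e.apply_symm_apply]
  refine ⟨(B.mapCoeffs e.symm.toRingEquiv smul_eq).map E.symm, fun j => ?_⟩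
  rw [Module.Basis.map_apply, Module.Basis.mapCoeffs_apply]
  exact E₀.apply_symm_apply (B j)

theorem exists_semiHom_surjective (f : K →ₐ[k] L) (hf : Function.Bijective (perfMap p f))
    (Y : Triple p k L) : ∃ (X : Triple p k K) (h : SemiHom f X Y), Function.Surjective h.b := by
  let b := Module.finBasis L Y.V
  obtain ⟨B, hB⟩ := exists_basis_coeffMap_eq (AlgEquiv.ofBijective (perfMap p f) hf)
    ((b.baseChange (PerfectClosure L p)).map Y.ψ)
  refine ⟨Triple.ofBasis Y.W B,
    { a :=
      { toFun := fun v : Fin _ → K => b.equivFun.symm fun j => f (v j)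
        map_add' := fun v w => by
          rw [← map_add]
          exact congrArg _ (funext fun j => map_add f (v j) (w j))
        map_smul' := fun c v => by
          rw [← map_smul]
          exact congrArg _ (funext fun j => map_mul f c (v j)) }
      b := (LinearMap.id : Y.W →ₗ[k] Y.W)
      comm := fun v => ?_ }, Function.surjective_id⟩
  refine Eq.trans ?_ (congrArg (coeffMap Y.W (perfMap p f))
    (Triple.ofBasis_ψ_one_tmul Y.W B v)).symm
  change Y.ψ (1 ⊗ₜ b.equivFun.symm fun j => f (v j)) = _
  simp only [Module.Basis.equivFun_symm_apply, TensorProduct.tmul_sum, map_sum]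
  refine Finset.sum_congr rfl fun j _ => ?_
  rw [coeffMap_smul, perfMap_of]
  refine Eq.trans ?_ (congrArg _ (hB j).symm)
  rw [Module.Basis.map_apply, Module.Basis.baseChange_apply, TensorProduct.tmul_smul,
    ← algebraMap_smul (PerfectClosure L p), map_smul]
  rfl

end OfBasis

/-! ### Closed immersions of affine group schemes -/

namespace AffineGroupScheme

variable {k : Type u} [Field k] {G H : AffineGroupScheme k} (φ : G ⟶ H)

theorem onPoints_map {R S : CommAlgCat.{u} k} (f : R ⟶ S) (g : G.points R) :
    onPoints φ S ((G.obj.map f).hom g) = (H.obj.map f).hom (onPoints φ R g) :=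
  congrArg (fun h => h.hom g) (φ.hom.naturality f)

theorem onPoints_homEquiv {A B : CommAlgCat.{u} k} (a : G.CoordinateRing A)
    (b : H.CoordinateRing B) {R : CommAlgCat.{u} k} (f : A ⟶ R) :
    onPoints φ R (a.homEquiv f) = b.homEquiv (comorphism φ a b ≫ f) := by
  rw [b.homEquiv_comp, comorphism, Equiv.apply_symm_apply, a.homEquiv_eq f]
  exact onPoints_map φ f _

theorem comorphism_eq_comp {A A' B B' : CommAlgCat.{u} k} (a : G.CoordinateRing A)
    (a' : G.CoordinateRing A') (b : H.CoordinateRing B) (b' : H.CoordinateRing B') :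
    comorphism φ a' b' =
      (b'.uniqueUpToIso b).hom ≫ comorphism φ a b ≫ (a.uniqueUpToIso a').hom := by
  have universal_point : a.homEquiv (a.uniqueUpToIso a').hom = a'.homEquiv (𝟙 A') :=
    a.homEquiv.apply_symm_apply _
  have universal_point' : b'.homEquiv (b'.uniqueUpToIso b).hom = b.homEquiv (𝟙 B) :=
    b'.homEquiv.apply_symm_apply _
  refine b'.homEquiv.injective ?_
  rw [b'.homEquiv_comp, universal_point', ← b.homEquiv_eq, ← onPoints_homEquiv, universal_point,
    onPoints_homEquiv φ a' b', Category.comp_id]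

variable {φ}

theorem isClosedImmersion_of_surjective {A B : CommAlgCat.{u} k} (a : G.CoordinateRing A)
    (b : H.CoordinateRing B) (h : Function.Surjective (comorphism φ a b).hom) :
    IsClosedImmersion φ := by
  intro A' B' a' b'
  rw [comorphism_eq_comp φ a a' b b']
  exact (CommAlgCat.algEquivOfIso (a.uniqueUpToIso a')).surjective.comp
    (h.comp (CommAlgCat.algEquivOfIso (b'.uniqueUpToIso b)).surjective)

theorem IsClosedImmersion.onPoints_injective (h : IsClosedImmersion φ) (R : CommAlgCat.{u} k) :
    Function.Injective (onPoints φ R) := by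
  obtain ⟨A, ⟨a⟩⟩ := G.property
  obtain ⟨B, ⟨b⟩⟩ := H.property
  have : Epi (comorphism φ a b) := ConcreteCategory.epi_of_surjective _ (h A B a b)
  intro x y hxy
  obtain ⟨f, rfl⟩ := a.homEquiv.surjective x
  obtain ⟨g, rfl⟩ := a.homEquiv.surjective y
  rw [onPoints_homEquiv φ a b, onPoints_homEquiv φ a b, b.homEquiv.apply_eq_iff_eq,
    cancel_epi] at hxy
  rw [hxy]

theorem IsClosedImmersion.mono (h : IsClosedImmersion φ) : Mono φ where
  right_cancellation _ _ e :=
    ObjectProperty.hom_ext _ (NatTrans.ext (funext fun R => GrpCat.hom_ext (MonoidHom.ext fun g =>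
      h.onPoints_injective R (congrArg (fun t => onPoints t R g) e))))

theorem IsClosedImmersion.homEquiv_mem_range_iff (h : IsClosedImmersion φ)
    {A B R : CommAlgCat.{u} k} (a : G.CoordinateRing A) (b : H.CoordinateRing B) (f : B ⟶ R) :
    b.homEquiv f ∈ (onPoints φ R).range ↔
      RingHom.ker (comorphism φ a b).hom ≤ RingHom.ker f.hom := by
  refine ⟨?_, fun hf => ?_⟩
  · rintro ⟨x, hx⟩ z hz
    obtain ⟨g, rfl⟩ := a.homEquiv.surjective x
    rw [onPoints_homEquiv φ a b, b.homEquiv.apply_eq_iff_eq] at hx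
    rw [← hx]
    exact (congrArg g.hom (RingHom.mem_ker.1 hz)).trans (map_zero g.hom)
  · let g := AlgHom.liftOfSurjective (comorphism φ a b).hom (h A B a b) f.hom hf
    refine ⟨a.homEquiv (CommAlgCat.ofHom g), ?_⟩
    rw [onPoints_homEquiv φ a b, b.homEquiv.apply_eq_iff_eq]
    exact CommAlgCat.hom_ext (AlgHom.ext (AlgHom.liftOfSurjective_apply _ (h A B a b) f.hom hf))

/-- The image of a closed immersion, as a closed subgroup scheme. -/
def IsClosedImmersion.range (h : IsClosedImmersion φ) : H.ClosedSubgroup where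
  carrier R := (onPoints φ R).range
  map_mem f g := by
    rintro ⟨x, rfl⟩
    exact ⟨(G.obj.map f).hom x, onPoints_map φ f x⟩
  closed _ b := by
    obtain ⟨_, ⟨a⟩⟩ := G.property
    exact ⟨_, fun _ f => h.homEquiv_mem_range_iff a b f⟩

end AffineGroupScheme

/-! ### The perfect closure of a purely inseparable extension -/

section PurelyInseparable

variable {p : ℕ} [Fact p.Prime] {k K : Type u} [Field k] [Field K] [CharP K p] [Algebra k K]

theorem perfMap_bijective {L : Type u} [Field L] [CharP L p] [Algebra k L] (f : K →ₐ[k] L)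
    [IsPRadical (f : K →+* L) p] : Function.Bijective (perfMap p f) := by
  refine ⟨(perfMap p f).toRingHom.injective, fun y => ?_⟩
  let i : K →+* PerfectClosure L p := (PerfectClosure.of L p).comp (f : K →+* L)
  have : IsPRadical i p := IsPRadical.trans (f : K →+* L) (PerfectClosure.of L p) p
  obtain ⟨n, c, pow_y⟩ := IsPRadical.pow_mem i p y
  obtain ⟨z, pow_z⟩ := (bijective_iterateFrobenius (PerfectClosure K p) p n).2
    (PerfectClosure.of K p c)
  refine ⟨z, (bijective_iterateFrobenius (PerfectClosure L p) p n).1 ?_⟩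
  rw [iterateFrobenius_def] at pow_z
  rw [iterateFrobenius_def, iterateFrobenius_def, ← map_pow, pow_z, perfMap_of, ← pow_y]
  rfl

/-- The isomorphism of perfect closures induced by a `p`-radical extension of fields over `k`. -/
def perfEquiv {L : Type u} [Field L] [CharP L p] [Algebra k L] (f : K →ₐ[k] L)
    [IsPRadical (f : K →+* L) p] : PerfectClosure K p ≃ₐ[k] PerfectClosure L p :=
  AlgEquiv.ofBijective (perfMap p f) (perfMap_bijective f)

namespace PI

instance isPRadical_toAlgHom (L : PI k K) :
    IsPRadical (IsScalarTower.toAlgHom k K L : K →+* L) p :=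
  inferInstanceAs (IsPRadical (algebraMap K L) p)

variable (p) in
/-- The embedding of a purely inseparable extension of `K` into the perfect closure of `K`. -/
def perfEmbedding (L : PI k K) : L →ₐ[K] PerfectClosure K p where
  __ := ((perfEquiv (p := p) (IsScalarTower.toAlgHom k K L)).symm :
    PerfectClosure L p →+* PerfectClosure K p).comp (PerfectClosure.of L p)
  commutes' c := (perfEquiv (p := p) (IsScalarTower.toAlgHom k K L)).symm_apply_eq.2
    (perfMap_of p (IsScalarTower.toAlgHom k K L) c).symm

theorem mem_range_perfEmbedding_iff (L : PI k K) (t : PerfectClosure K p) :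
    t ∈ (L.perfEmbedding p).range ↔
      perfMap p (IsScalarTower.toAlgHom k K L) t ∈ (PerfectClosure.of L p).range :=
  exists_congr fun _ => (perfEquiv (p := p) (IsScalarTower.toAlgHom k K L)).symm_apply_eq

variable (p) in
theorem exists_hom_of_range_perfEmbedding_le {L M : PI k K}
    (h : (L.perfEmbedding p).range ≤ (M.perfEmbedding p).range) : Nonempty (L ⟶ M) :=
  ⟨(AlgEquiv.ofInjectiveField (M.perfEmbedding p)).symm.toAlgHom.comp
    ((L.perfEmbedding p).codRestrict _ fun x => h ⟨x, rfl⟩)⟩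

end PI

end PurelyInseparable

/-! ### Restriction to a purely inseparable extension -/

section ClosedImmersion

variable {p : ℕ} [Fact p.Prime] {k K L : Type u} [Field k] [Field K] [Field L] [CharP K p]
  [CharP L p] [Algebra k K] [Algebra k L] {R S : Type u} [CommRing R] [Algebra k R] [CommRing S]
  [Algebra k S]

theorem map_signed (F : tensorAut p k K R →* tensorAut p k L S) (g : tensorAut p k K R)
    (s : Bool) : F (signed g s) = signed (F g) s := by
  cases s
  · exact map_inv F g
  · rfl

variable (p k K) in
theorem adjoin_range_mk_X : Algebra.adjoin k (Set.range fun x : Coeff p k K =>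
    Ideal.Quotient.mkₐ k (coordIdeal p k K) (MvPolynomial.X x)) = ⊤ := by
  rw [← Function.comp_def, Set.range_comp, ← AlgHom.map_adjoin, MvPolynomial.adjoin_range_X,
    Algebra.map_top]
  exact (AlgHom.range_eq_top _).2 (Ideal.Quotient.mkₐ_surjective k _)

theorem repr_univAut_signed (c : Code p K) (s : Bool) (i j) :
    ((repBasis c).baseChange (CoordRing p k K)).repr
        (((signed (univAut p k K) s).1 (rep c)).val (1 ⊗ₜ repBasis c j)) i =
      Ideal.Quotient.mkₐ k (coordIdeal p k K) (MvPolynomial.X ⟨c, s, i, j⟩) := by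
  rw [univAut_signed, univEnd_basis, map_sum, Finset.sum_apply']
  simp [Module.Basis.baseChange_repr_tmul, Finsupp.single_apply]

theorem val_tmul_of_res_eq {f : K →ₐ[k] L} {φ : R →ₐ[k] S} {g : tensorAut p k L S}
    {g₀ : tensorAut p k K R} (hg : res p f S g = tensorAutMap p k K φ g₀) {X : Triple p k K}
    {Y : Triple p k L} (h : SemiHom f X Y) (w : X.W) :
    (g.1 Y).val (1 ⊗ₜ h.b w) = coeffMap Y.W φ (h.b.baseChange R ((g₀.1 X).val (1 ⊗ₜ w))) := by
  have natural := resFamily_natural g.2 h (1 ⊗ₜ w)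
  have val_res : (resFamily f g.1 X).val (1 ⊗ₜ w) = coeffMap X.W φ ((g₀.1 X).val (1 ⊗ₜ w)) := by
    rw [← coeffMap_units φ X.W (g₀.1 X), LinearMap.rTensor_tmul, AlgHom.toLinearMap_apply, map_one]
    exact congrArg (fun a : tensorAut p k K S => (a.1 X).val (1 ⊗ₜ w)) hg
  rw [LinearMap.baseChange_tmul, val_res] at natural
  rw [natural, coeffMap_baseChange]

theorem evalAt_res_univAut_surjective (f : K →ₐ[k] L) (hf : Function.Bijective (perfMap p f)) :
    Function.Surjective
      (evalAt (CommAlgCat.of k (CoordRing p k L)) (res p f _ (univAut p k L))) := by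
  let φ : CoordRing p k K →ₐ[k] CoordRing p k L :=
    evalAt (CommAlgCat.of k (CoordRing p k L)) (res p f _ (univAut p k L))
  refine (AlgHom.range_eq_top φ).1 (top_le_iff.1 ?_)
  rw [← adjoin_range_mk_X, Algebra.adjoin_le_iff]
  rintro _ ⟨⟨c, s, i, j⟩, rfl⟩
  obtain ⟨X, h, h_surjective⟩ := exists_semiHom_surjective f hf (rep (k := k) c)
  obtain ⟨w, hw⟩ := h_surjective (repBasis c j)
  have res_signed : res p f _ (signed (univAut p k L) s) =
      tensorAutMap p k K φ (signed (univAut p k K) s) := by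
    rw [map_signed, map_signed]
    exact congrArg (signed · s) (map_evalAt (CommAlgCat.of k (CoordRing p k L)) _).symm
  have coefficient := repr_univAut_signed (k := k) c s i j
  rw [← hw, val_tmul_of_res_eq res_signed h, repr_coeffMap] at coefficient
  exact ⟨_, coefficient⟩

theorem comorphism_piLMap (f : K →ₐ[k] L) :
    AffineGroupScheme.comorphism (piLMap p f) (autRepresentable p k L) (autRepresentable p k K) =
      CommAlgCat.ofHom
        (evalAt (CommAlgCat.of k (CoordRing p k L)) (res p f _ (univAut p k L))) := by
  have universal_point : (autRepresentable p k L).homEquiv (𝟙 _) = univAut p k L :=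
    congrArg (fun t => t.hom (univAut p k L))
      ((autFunctor p k L).map_id (CommAlgCat.of k (CoordRing p k L)))
  exact congrArg (fun t => CommAlgCat.ofHom (evalAt _ (res p f _ t))) universal_point

theorem isClosedImmersion_piLMap (f : K →ₐ[k] L) (hf : Function.Bijective (perfMap p f)) :
    AffineGroupScheme.IsClosedImmersion (piLMap p f) := by
  refine AffineGroupScheme.isClosedImmersion_of_surjective (autRepresentable p k L)
    (autRepresentable p k K) ?_
  rw [comorphism_piLMap]
  exact evalAt_res_univAut_surjective f hf

variable (p) in
theorem PI.isClosedImmersion_toBase (L : PI k K) :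
    AffineGroupScheme.IsClosedImmersion (L.toBase p) :=
  isClosedImmersion_piLMap _ (perfMap_bijective _)

end ClosedImmersion

section SubgroupEmbedding

open AffineGroupScheme (onPoints)

variable {p : ℕ} [Fact p.Prime] {k K : Type u} [Field k] [Field K] [CharP K p] [Algebra k K]

namespace PI

theorem mem_range_perfEmbedding_iff_fixed (L : PI k K) (t : PerfectClosure K p) :
    t ∈ (L.perfEmbedding p).range ↔
      ∀ (R : CommAlgCat.{u} k), ∀ g ∈ (onPoints (L.toBase p) R).range,
        (g.1 (Triple.unipotent k t)).val (1 ⊗ₜ (Triple.unipotentFrame k t).w₁) =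
          1 ⊗ₜ (Triple.unipotentFrame k t).w₁ := by
  let F := (Triple.unipotentFrame k t).pullback (IsScalarTower.toAlgHom k K L)
  rw [mem_range_perfEmbedding_iff, F.mem_range_iff]
  refine ⟨?_, fun h R _ _ g hg => h (CommAlgCat.of k R) _ ⟨⟨g, hg⟩, rfl⟩⟩
  rintro h R _ ⟨g, rfl⟩
  exact h R g.1 g.2

variable (p) in
theorem exists_hom_of_range_le {L M : PI k K}
    (h : ∀ R, (onPoints (L.toBase p) R).range ≤ (onPoints (M.toBase p) R).range) :
    Nonempty (M ⟶ L) :=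
  exists_hom_of_range_perfEmbedding_le p fun t ht =>
    (mem_range_perfEmbedding_iff_fixed L t).2 fun R g hg =>
      (mem_range_perfEmbedding_iff_fixed M t).1 ht R g (h R hg)

theorem range_le_of_over {L M : PI k K} {φ : piL p k L ⟶ piL p k M}
    (hφ : φ ≫ M.toBase p = L.toBase p) (R : CommAlgCat.{u} k) :
    (onPoints (L.toBase p) R).range ≤ (onPoints (M.toBase p) R).range := by
  rintro _ ⟨g, rfl⟩
  exact ⟨onPoints φ R g, congrArg (onPoints · R g) hφ⟩

variable (p) in
/-- The closed subgroup scheme `π(L/k) ⊆ π(K/k)`. -/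
def closedSubgroup (L : PI k K) : (piL p k K).ClosedSubgroup :=
  (L.isClosedImmersion_toBase p).range

theorem closedSubgroup_le_iff {L M : PI k K} :
    L.closedSubgroup p ≤ M.closedSubgroup p ↔ Nonempty (M ⟶ L) :=
  ⟨exists_hom_of_range_le p, fun ⟨f⟩ => range_le_of_over (map_toBase p f)⟩

end PI

variable (p k K) in
/-- The closed subgroup scheme `π(L/k) ⊆ π(K/k)` as a function of the isomorphism class
of `L`. -/
def subgroupEmbedding : (ThinSkeleton (PI k K))ᵒᵈ ↪o (piL p k K).ClosedSubgroup :=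
  OrderEmbedding.ofMapLEIff
    (Quotient.lift (s := isIsomorphicSetoid (PI k K)) (PI.closedSubgroup p) (fun _ _ ⟨i⟩ =>
      le_antisymm (PI.closedSubgroup_le_iff.2 ⟨i.inv⟩) (PI.closedSubgroup_le_iff.2 ⟨i.hom⟩)) ∘
        OrderDual.ofDual)
    (by
      rintro ⟨L⟩ ⟨M⟩
      exact PI.closedSubgroup_le_iff)

instance piFunctor_full : (piFunctor k K p).Full where
  map_surjective {L M} φ := by
    have comm : φ.left ≫ M.unop.toBase p = L.unop.toBase p := Over.w φ
    obtain ⟨f⟩ := PI.exists_hom_of_range_le p (PI.range_le_of_over comm)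
    have : Mono (M.unop.toBase p) := (M.unop.isClosedImmersion_toBase p).mono
    exact ⟨f.op, Over.OverMorphism.ext <|
      (cancel_mono (M.unop.toBase p)).1 ((PI.map_toBase p f).trans comm.symm)⟩

instance piFunctor_faithful : (piFunctor k K p).Faithful where
  map_injective _ := Subsingleton.elim _ _

end SubgroupEmbedding

end LocalNori

end

theorem theoremI_general (p : ℕ) [Fact p.Prime] (k K : Type u) [Field k] [Field K] [CharP K p]
    [Algebra k K] :
    (LocalNori.piFunctor k K p).Full ∧ (LocalNori.piFunctor k K p).Faithful ∧
    (∀ L : LocalNori.PI k K, LocalNori.AffineGroupScheme.IsClosedImmersion (L.toBase p)) ∧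
    ∃ e : (ThinSkeleton (LocalNori.PI k K))ᵒᵈ ↪o (LocalNori.piL p k K).ClosedSubgroup,
      ∀ (L : LocalNori.PI k K) (R : CommAlgCat.{u} k),
        (e (OrderDual.toDual (ThinSkeleton.mk L))).carrier R =
          (LocalNori.AffineGroupScheme.onPoints (L.toBase p) R).range :=
  ⟨LocalNori.piFunctor_full, LocalNori.piFunctor_faithful,
    LocalNori.PI.isClosedImmersion_toBase p, LocalNori.subgroupEmbedding p k K, fun _ _ => rfl⟩

theorem theoremI (p : ℕ) [Fact p.Prime] (k K : Type u) [Field k] [PerfectField k] [CharP k p]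
    [Field K] [CharP K p] [Algebra k K] :
    (LocalNori.piFunctor k K p).Full ∧ (LocalNori.piFunctor k K p).Faithful ∧
    (∀ L : LocalNori.PI k K, LocalNori.AffineGroupScheme.IsClosedImmersion (L.toBase p)) ∧
    ∃ e : (ThinSkeleton (LocalNori.PI k K))ᵒᵈ ↪o (LocalNori.piL p k K).ClosedSubgroup,
      ∀ (L : LocalNori.PI k K) (R : CommAlgCat.{u} k),
        (e (OrderDual.toDual (ThinSkeleton.mk L))).carrier R =
          (LocalNori.AffineGroupScheme.onPoints (L.toBase p) R).range :=
  theoremI_general p k K
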